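/- For every $k\ge 1$ let $\mathcal S_k$ be a finite nonempty set, let $A_k$ be a real matrix indexed by $\mathcal S_k\times\mathcal S_k$ with nonnegative off-diagonal entries, and let $D_k$ be a nonnegative real matrix indexed by $\mathcal S_k\times\mathcal S_{k+1}$, such that $A_k\mathbf 1+D_k\mathbf 1=\mathbf 0$ and all states of $\mathcal S_k$ are transient, i.e. $e^{A_kt}\to 0$ as $t\to\infty$. Let $\boldsymbol\alpha$ be a probability vector on $\mathcal S_1$. For $n\ge 1$ let $\varphi^{(n)}$ be a Markov jump process on $\{\star\}\cup\mathcal S_1\cup\dots\cup\mathcal S_n$ that starts in $\mathcal S_1$ according to $\boldsymbol\alpha$; its transition rates inside $\mathcal S_k$ are given by $A_k$, those from $\mathcal S_k$ to $\mathcal S_{k+1}$ ($k<n$) by $D_k$, those from $\mathcal S_n$ to $\star$ by $D_n\mathbf 1$, all other rates between distinct states are $0$, and $\star$ is absorbing. Let $Y_1,Y_2,\dots$ be random variables such that, for every $n\ge 1$, $$(Y_1,\dots,Y_n)\stackrel{d}{=}\Big(\int_0^\infty \mathbf 1\{\varphi^{(n)}(s)\in\mathcal S_k\}\,ds\Big)_{1\le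 k\le n}.$$ Let $u\ge 0$, $c>0$, and let $\{N(t)\mid t\ge 0\}$ be a Poisson process of intensity $\lambda>0$ such that, for every $n\ge 1$, $(Y_1,\dots,Y_n)$ is independent of $\{N(t)\}$. Assume that there are $p\in\mathbb N$, $\nu<\infty$ and $\sigma>0$ such that (A1) $|\mathcal S_k|\le p$ for all $k\ge 1$; (A2) $(-A_k\mathbf 1)_i\le\nu$ for all $k\ge 1$ and $i\in\mathcal S_k$; (A3) for all $k\ge1$, the dominant eigenvalue of $A_k$ (the eigenvalue with the largest real part) is at most $-\sigma$. Let $\{L_k\}_{k\ge 1}$ be an i.i.d. sequence of exponential random variables with rate $\nu$ and $\{H_k\}_{k\ge 1}$ an i.i.d. sequence of Erlang random variables with $p$ stages of rate $\sigma$ (density $\sigma^p x^{p-1}e^{-\sigma x}/(p-1)!$ on $[0,\infty)$), each of the two sequences being independent of $\{N(t)\}$. Put $$R(t)=u+ct-\sum_{k=1}^{N(t)}Y_k,\qquad R_L(t)=u+ct-\sum_{k=1}^{N(t)}L_k,\qquad R_H(t)=u+ct-\sum_{k=1}^{N(t)}H_k .$$ Then $$\mathbb P\Big(\inf_{t\ge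 0}R_L(t)<0\Big)\;\le\;\mathbb P\Big(\inf_{t\ge 0}R(t)<0\Big)\;\le\;\mathbb P\Big(\inf_{t\ge 0}R_H(t)<0\Big).$$ -/

import Mathlib

open MeasureTheory ProbabilityTheory Filter Topology
open scoped NNReal ENNReal Matrix

noncomputable section

/-! ### Markov jump processes on a finite state space -/

/-- `φ` is a time-homogeneous Markov jump process on the finite set `E`, under the probability
measure `P`, with generator `Λ` and initial distribution `π₀`: its finite-dimensional
distributions are given by `π₀` and by the transition semigroup `exp (t Λ)`, and almost every path
is right-continuous with left limits for the discrete topology of `E`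
(that is, piecewise constant). -/
structure IsMarkovJumpProcess {E Ω : Type*} [Fintype E] [DecidableEq E] [MeasurableSpace Ω]
    (Λ : Matrix E E ℝ) (π₀ : E → ℝ) (φ : ℝ≥0 → Ω → E) (P : Measure Ω) : Prop where
  measurableSet_eq : ∀ (t : ℝ≥0) (i : E), MeasurableSet {ω | φ t ω = i}
  right_continuous : ∀ᵐ ω ∂P, ∀ t : ℝ≥0, ∀ᶠ s in 𝓝[≥] t, φ s ω = φ t ω
  left_limits : ∀ᵐ ω ∂P, ∀ t : ℝ≥0, ∃ i : E, ∀ᶠ s in 𝓝[<] t, φ s ω = i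
  finite_dim : ∀ (n : ℕ) (t : ℕ → ℝ≥0) (x : ℕ → E), Monotone t → t 0 = 0 →
    P.real {ω | ∀ j ≤ n, φ (t j) ω = x j} =
      π₀ (x 0) * ∏ j ∈ Finset.range n,
        NormedSpace.exp (((t (j + 1) : ℝ) - (t j : ℝ)) • Λ) (x j) (x (j + 1))

/-! ### Dependent phase-type claims -/

/-- The parameters of a sequence of dependent phase-type claims. The blocks `S₁, S₂, …` of
transient states are indexed from `0`: the `k`-th block is `Fin (dim k)`. The process starts in
the block `0` according to `α`; `A k` holds the rates inside the block `k` and `D k` the rates from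
the block `k` to the next one. -/
structure PhaseTypeRep where
  dim : ℕ → ℕ
  α : Fin (dim 0) → ℝ
  A : ∀ k, Matrix (Fin (dim k)) (Fin (dim k)) ℝ
  D : ∀ k, Matrix (Fin (dim k)) (Fin (dim (k + 1))) ℝ
  α_nonneg : ∀ i, 0 ≤ α i
  α_sum : ∑ i, α i = 1
  A_nonneg : ∀ k i j, i ≠ j → 0 ≤ A k i j
  D_nonneg : ∀ k i j, 0 ≤ D k i j
  /-- The rows of the generator sum to zero. -/
  row_sum : ∀ k i, ∑ j, A k i j + ∑ j, D k i j = 0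
  /-- All states of every block are transient: since a block is never re-entered, this says that
  the process almost surely leaves it. -/
  transient : ∀ k i j, Tendsto (fun t : ℝ => NormedSpace.exp (t • A k) i j) atTop (𝓝 0)

namespace PhaseTypeRep

/-- The state space `{⋆} ∪ S₁ ∪ ⋯ ∪ Sₙ`; the absorbing state `⋆` is `none`, and `some ⟨k, i⟩` is
the state `i` of the block `k`. -/
abbrev State (M : PhaseTypeRep) (n : ℕ) : Type := Option (Σ k : Fin n, Fin (M.dim k))

/-- The generator on `{⋆} ∪ S₁ ∪ ⋯ ∪ Sₙ`: the rates `A k` inside a block, the rates `D k` from a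
block to the next one, and the row sums of the last `D` as the rates of absorption. -/
def generator (M : PhaseTypeRep) (n : ℕ) : Matrix (M.State n) (M.State n) ℝ
  | none, _ => 0
  | some ⟨k, i⟩, none => if (k : ℕ) + 1 = n then ∑ j, M.D k i j else 0
  | some ⟨k, i⟩, some ⟨l, j⟩ =>
      if h : (l : ℕ) = k then M.A k i (Fin.cast (congrArg M.dim h) j)
      else if h : (l : ℕ) = k + 1 then M.D k i (Fin.cast (congrArg M.dim h) j)
      else 0

/-- The initial distribution `[0 | α 0 ⋯ 0]`. -/
def initial (M : PhaseTypeRep) (n : ℕ) : M.State n → ℝ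
  | none => 0
  | some ⟨k, i⟩ => if h : (k : ℕ) = 0 then M.α (Fin.cast (congrArg M.dim h) i) else 0

/-- The time `∫₀^∞ 1{φ(s) ∈ S_k} ds` that the path `φ` spends in the block `k`. -/
def timeIn (M : PhaseTypeRep) {n : ℕ} (φ : ℝ≥0 → M.State n) (k : Fin n) : ℝ≥0∞ :=
  volume {s : ℝ | 0 ≤ s ∧ ∃ i : Fin (M.dim k), φ s.toNNReal = some ⟨k, i⟩}

end PhaseTypeRep

/-- The random vector `Y = (Y₁, …, Yₙ)` follows the multivariate phase-type distribution with
representation `M`: it is distributed as the vector of the times spent in the blocks `S₁, …, Sₙ`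
by a Markov jump process with generator `M.generator n` and initial distribution `M.initial n`.
These times are almost surely finite, because all the blocks are transient. -/
def IsMultivariatePhaseType {Ω : Type*} [MeasurableSpace Ω] (M : PhaseTypeRep) (n : ℕ)
    (Y : Ω → Fin n → ℝ) (P : Measure Ω) : Prop :=
  ∃ (Ω' : Type) (_ : MeasurableSpace Ω') (P' : Measure Ω') (_ : IsProbabilityMeasure P')
    (φ : ℝ≥0 → Ω' → M.State n),
    IsMarkovJumpProcess (M.generator n) (M.initial n) φ P' ∧
    IdentDistrib Y (fun ω' k => (M.timeIn (fun s => φ s ω') k).toReal) P P'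

/-- `z` is a dominant eigenvalue of the real square matrix `B`: a (complex) eigenvalue with the
largest real part. -/
def IsDominantEigenvalue {d : ℕ} (B : Matrix (Fin d) (Fin d) ℝ) (z : ℂ) : Prop :=
  Module.End.HasEigenvalue (Matrix.toLin' (B.map Complex.ofReal)) z ∧
    ∀ w : ℂ, Module.End.HasEigenvalue (Matrix.toLin' (B.map Complex.ofReal)) w → w.re ≤ z.re

/-! ### Risk processes -/

/-- `N` is a Poisson (counting) process of intensity `lam`. The paths are monotone, so that the
difference of natural numbers is the true increment. -/
structure IsPoissonProcess {Ω : Type*} [MeasurableSpace Ω] (lam : ℝ≥0) (N : ℝ≥0 → Ω → ℕ)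
    (P : Measure Ω) : Prop where
  measurable : ∀ t, Measurable (N t)
  zero : ∀ᵐ ω ∂P, N 0 ω = 0
  monotone : ∀ᵐ ω ∂P, Monotone fun t => N t ω
  right_continuous : ∀ᵐ ω ∂P, ∀ t : ℝ≥0, ∀ᶠ s in 𝓝[≥] t, N s ω = N t ω
  indep_increments : HasIndepIncrements N P
  law_increments : ∀ s t : ℝ≥0, s ≤ t →
    HasLaw (fun ω => N t ω - N s ω) (poissonMeasure (lam * (t - s))) P

/-- The reserve `R(t) = u + c t - ∑_{k=1}^{N(t)} X_k`; the claims are indexed from `0`. -/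
def reserve {Ω : Type*} (u c : ℝ) (N : ℝ≥0 → Ω → ℕ) (X : ℕ → Ω → ℝ) (t : ℝ≥0) (ω : Ω) : ℝ :=
  u + c * t - ∑ k ∈ Finset.range (N t ω), X k ω

/-- The event of ultimate ruin `inf_{t ≥ 0} R(t) < 0`; the infimum is taken in the extended reals,
so that it makes sense for paths which are not bounded below. -/
def ultimateRuin {Ω : Type*} (R : ℝ≥0 → Ω → ℝ) : Set Ω :=
  {ω | (⨅ t : ℝ≥0, (R t ω : EReal)) < 0}

end

/-! Ruin is compared through the partial sums `S₁ ≤ S₂ ≤ ⋯` of the claims. By right-continuity of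
`N`, a countable dense set of times detects ruin, and finite subsets exhaust it. Given the values of
`N` at finitely many times, survival at these times is an event `S_{m+1} ≤ ρ_m` for all `m < n`,
with deterministic nondecreasing barriers `ρ` (`measure_ultimateRuin_le`). Since `N` is independent
of the claims, it suffices to compare the probabilities of such events.

One block: entered in the state `i`, the block `k` is still occupied after time `t` with probability
`(exp (t A_k) 1)_i`. This is at least `exp (-ν t)`, as the exit rates are at most `ν`. It is at most
the Erlang tail (`exp_smul_mulVec_one_le_erlang`): for `0 < s < σ` the matrix `M = A_k + s I` has a
vector `v > 0` with `M v ≤ 0`, so the coordinate of `exp (t M) 1` at which `v` is smallest never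
exceeds `1`. Deleting that state costs one integration for the others, and induction on the number
of states gives `exp (t M) 1 ≤ ∑_{j < d} (s t)^j / j!`; then multiply by `exp (-s t)` and let `s →
σ`.

Several blocks: the claims depend on each other only through the entry states, and the tail bounds
hold for every entry state, so blocks can be traded for independent steps. The level of the path is
nondecreasing, and `S_{m+1} ≤ ρ_m` says that the first `m + 1` blocks are left by time `ρ_m`
(`sum_timeIn_le_iff`), an event whose probability comes from iterating the semigroup backwards
(`backwardProb`). Let `w_k` be the survival probability of the i.i.d. walk from step `k` on, and
`z_k` the one in which only step `k` is replaced by the true block (`hybridSurvival`). Applying `∂_t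
+ Λ` to `z` leaves `D_k (z_{k+1} - w_{k+1})`. Its sign is fixed by the stochastic order of a single
step, as `w` is antitone in time. Hence `z` is a sub- or supersolution of the backward equation, and
a comparison principle for matrices with nonnegative off-diagonal entries concludes. -/

/-! ### Exponentials of matrices: shift, positivity, derivative -/

section Metzler

variable {ι : Type*} [Fintype ι] [DecidableEq ι]

theorem exp_smul_add_smul_one (A : Matrix ι ι ℝ) (r t : ℝ) :
    NormedSpace.exp (t • (A + r • (1 : Matrix ι ι ℝ))) =
      Real.exp (t * r) • NormedSpace.exp (t • A) := by
  have h1 : t • (A + r • (1 : Matrix ι ι ℝ)) = t • A + Matrix.diagonal (fun _ => t * r) := by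
    rw [smul_add, smul_smul, Matrix.smul_one_eq_diagonal]
  have hd : Matrix.diagonal (fun _ : ι => t * r) = (t * r) • (1 : Matrix ι ι ℝ) :=
    (Matrix.smul_one_eq_diagonal _).symm
  rw [h1, Matrix.exp_add_of_commute _ _ (by rw [hd]; exact (Commute.one_right _).smul_right _),
    Matrix.exp_diagonal]
  have h2 : NormedSpace.exp (fun _ : ι => t * r) = fun _ => Real.exp (t * r) := by
    rw [Real.exp_eq_exp_ℝ]
    exact funext fun i => Pi.coe_exp _ i
  rw [h2, ← Matrix.smul_one_eq_diagonal, Matrix.mul_smul, mul_one]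

attribute [local instance] Matrix.linftyOpNormedRing Matrix.linftyOpNormedAlgebra
  Matrix.linftyOpNormedAddCommGroup Matrix.linftyOpNormedSpace

theorem hasDerivAt_exp_smul_matrix (A : Matrix ι ι ℝ) (t : ℝ) :
    HasDerivAt (fun s : ℝ => NormedSpace.exp (s • A)) (A * NormedSpace.exp (t • A)) t :=
  hasDerivAt_exp_smul_const' A t

theorem exp_nonneg_of_nonneg {A : Matrix ι ι ℝ} (hA : ∀ i j, 0 ≤ A i j) (i j : ι) :
    0 ≤ NormedSpace.exp A i j := by
  have hs := NormedSpace.exp_series_hasSum_exp' (𝕂 := ℝ) A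
  have hs2 : HasSum (fun n : ℕ => (((n.factorial : ℝ)⁻¹ • A ^ n) i j)) (NormedSpace.exp A i j) :=
    Pi.hasSum.1 (Pi.hasSum.1 hs i) j
  refine hs2.nonneg fun n => ?_
  have hp : ∀ n : ℕ, ∀ i j, 0 ≤ (A ^ n) i j := by
    intro n
    induction n with
    | zero => intro i j; simp only [pow_zero, Matrix.one_apply]; split_ifs <;> norm_num
    | succ n ih =>
      intro i j
      rw [pow_succ, Matrix.mul_apply]
      exact Finset.sum_nonneg fun k _ => mul_nonneg (ih i k) (hA k j)
  rw [Matrix.smul_apply, smul_eq_mul]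
  exact mul_nonneg (by positivity) (hp n i j)

/-- In entrywise form no norm on matrices appears any more, so the local instances are not needed
later. -/
theorem hasDerivAt_exp_smul_entry (A : Matrix ι ι ℝ) (t : ℝ) (i j : ι) :
    HasDerivAt (fun s : ℝ => NormedSpace.exp (s • A) i j) ((A * NormedSpace.exp (t • A)) i j) t :=
  hasDerivAt_pi.1 (hasDerivAt_pi.1 (hasDerivAt_exp_smul_matrix A t) i) j

theorem commute_exp_smul (A : Matrix ι ι ℝ) (t : ℝ) :
    A * NormedSpace.exp (t • A) = NormedSpace.exp (t • A) * A :=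
  ((Commute.refl A).smul_right t).exp_right

theorem exp_add_smul (A : Matrix ι ι ℝ) (s t : ℝ) :
    NormedSpace.exp ((s + t) • A) = NormedSpace.exp (s • A) * NormedSpace.exp (t • A) := by
  rw [add_smul, Matrix.exp_add_of_commute]
  exact ((Commute.refl A).smul_left s).smul_right t

end Metzler

/-! ### Comparison principle for matrices with nonnegative off-diagonal entries -/

section Comparison

variable {ι : Type*} [Fintype ι] [DecidableEq ι]

theorem exp_smul_nonneg {A : Matrix ι ι ℝ} (hA : ∀ i j, i ≠ j → 0 ≤ A i j) {t : ℝ} (ht : 0 ≤ t)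
    (i j : ι) : 0 ≤ NormedSpace.exp (t • A) i j := by
  -- This `r` exceeds every `-A k k`, so `A + r • 1` is entrywise nonnegative; the shift only
  -- multiplies the exponential by a positive scalar.
  set r : ℝ := ∑ k, |A k k| with hr
  have hB : ∀ i j, 0 ≤ (t • (A + r • (1 : Matrix ι ι ℝ))) i j := by
    intro i j
    rw [Matrix.smul_apply, Matrix.add_apply, Matrix.smul_apply, smul_eq_mul, smul_eq_mul]
    refine mul_nonneg ht ?_
    by_cases h : i = j
    · subst h
      rw [Matrix.one_apply_eq, mul_one]
      have h1 : |A i i| ≤ r := Finset.single_le_sum (f := fun k => |A k k|)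
        (fun k _ => abs_nonneg _) (Finset.mem_univ i)
      linarith [neg_abs_le (A i i)]
    · rw [Matrix.one_apply_ne h, mul_zero, add_zero]
      exact hA i j h
  have h := exp_nonneg_of_nonneg hB i j
  rw [exp_smul_add_smul_one, Matrix.smul_apply, smul_eq_mul] at h
  exact nonneg_of_mul_nonneg_right h (Real.exp_pos _)

theorem exp_smul_mulVec_mono {A : Matrix ι ι ℝ} (hA : ∀ i j, i ≠ j → 0 ≤ A i j) {t : ℝ}
    (ht : 0 ≤ t) {v w : ι → ℝ} (hvw : ∀ i, v i ≤ w i) (i : ι) :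
    (NormedSpace.exp (t • A) *ᵥ v) i ≤ (NormedSpace.exp (t • A) *ᵥ w) i :=
  Finset.sum_le_sum fun j _ => mul_le_mul_of_nonneg_left (hvw j) (exp_smul_nonneg hA ht i j)

theorem exp_smul_mulVec_nonneg {A : Matrix ι ι ℝ} (hA : ∀ i j, i ≠ j → 0 ≤ A i j) {t : ℝ}
    (ht : 0 ≤ t) {v : ι → ℝ} (hv : ∀ i, 0 ≤ v i) (i : ι) :
    0 ≤ (NormedSpace.exp (t • A) *ᵥ v) i :=
  Finset.sum_nonneg fun j _ => mul_nonneg (exp_smul_nonneg hA ht i j) (hv j)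

theorem hasDerivAt_exp_smul_mulVec (A : Matrix ι ι ℝ) (v : ι → ℝ) (t : ℝ) (i : ι) :
    HasDerivAt (fun s : ℝ => (NormedSpace.exp (s • A) *ᵥ v) i)
      ((A *ᵥ (NormedSpace.exp (t • A) *ᵥ v)) i) t := by
  rw [Matrix.mulVec_mulVec]
  exact HasDerivAt.fun_sum fun j _ => (hasDerivAt_exp_smul_entry A t i j).mul_const (v j)

theorem hasDerivAt_exp_sub_smul_mulVec (A : Matrix ι ι ℝ) (a s : ℝ) {f f' : ℝ → ι → ℝ}
    (hf : ∀ i, HasDerivAt (fun x => f x i) (f' s i) s) (i : ι) :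
    HasDerivAt (fun x : ℝ => (NormedSpace.exp ((x - a) • A) *ᵥ f x) i)
      ((NormedSpace.exp ((s - a) • A) *ᵥ (A *ᵥ f s + f' s)) i) s := by
  have hd : ∀ j, HasDerivAt (fun x : ℝ => NormedSpace.exp ((x - a) • A) i j * f x j)
      ((A * NormedSpace.exp ((s - a) • A)) i j * f s j
        + NormedSpace.exp ((s - a) • A) i j * f' s j) s := by
    intro j
    have h1 := (hasDerivAt_exp_smul_entry A (s - a) i j).comp s ((hasDerivAt_id s).sub_const a)
    rw [mul_one] at h1
    exact h1.mul (hf j)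
  have := HasDerivAt.fun_sum (u := Finset.univ) fun j _ => hd j
  refine this.congr_deriv ?_
  rw [Finset.sum_add_distrib, Matrix.mulVec_add, Matrix.mulVec_mulVec, commute_exp_smul]
  rfl

/-- A subsolution of the backward equation `f' + A f = 0` is dominated by the solution. -/
theorem le_exp_smul_mulVec {A : Matrix ι ι ℝ} (hA : ∀ i j, i ≠ j → 0 ≤ A i j) {a b : ℝ}
    (hab : a ≤ b) {f f' : ℝ → ι → ℝ}
    (hf : ∀ s ∈ Set.Icc a b, ∀ i, HasDerivAt (fun x => f x i) (f' s i) s)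
    (hsub : ∀ s ∈ Set.Icc a b, ∀ i, 0 ≤ (A *ᵥ f s) i + f' s i) (i : ι) :
    f a i ≤ (NormedSpace.exp ((b - a) • A) *ᵥ f b) i := by
  have hd := fun s (hs : s ∈ Set.Icc a b) => hasDerivAt_exp_sub_smul_mulVec A a s (hf s hs) i
  -- The derivative of `exp ((x - a) A) f(x)` is `exp ((x - a) A) (A f + f')`, nonnegative because
  -- the exponential is.
  have hm : MonotoneOn (fun x : ℝ => (NormedSpace.exp ((x - a) • A) *ᵥ f x) i) (Set.Icc a b) := by
    refine monotoneOn_of_hasDerivWithinAt_nonneg (convex_Icc a b)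
      (fun s hs => (hd s hs).continuousAt.continuousWithinAt)
      (fun s hs => (hd s (interior_subset hs)).hasDerivWithinAt) fun s hs => ?_
    have hs' := interior_subset hs
    exact exp_smul_mulVec_nonneg hA (sub_nonneg.2 hs'.1) (hsub s hs') i
  have := hm (Set.left_mem_Icc.2 hab) (Set.right_mem_Icc.2 hab) hab
  simpa using this

theorem exp_smul_mulVec_le {A : Matrix ι ι ℝ} (hA : ∀ i j, i ≠ j → 0 ≤ A i j) {a b : ℝ}
    (hab : a ≤ b) {f f' : ℝ → ι → ℝ}
    (hf : ∀ s ∈ Set.Icc a b, ∀ i, HasDerivAt (fun x => f x i) (f' s i) s)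
    (hsuper : ∀ s ∈ Set.Icc a b, ∀ i, (A *ᵥ f s) i + f' s i ≤ 0) (i : ι) :
    (NormedSpace.exp ((b - a) • A) *ᵥ f b) i ≤ f a i := by
  have h := le_exp_smul_mulVec hA hab (f := fun s => -f s) (f' := fun s => -f' s)
    (fun s hs i => (hf s hs i).neg) (fun s hs i => by
      have := hsuper s hs i
      rw [Matrix.mulVec_neg, Pi.neg_apply, Pi.neg_apply]
      linarith) i
  simp only [Matrix.mulVec_neg, Pi.neg_apply] at h
  linarith

/-- A supersolution of the forward equation `f' = A f` dominates the solution. -/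
theorem exp_smul_mulVec_le_of_forward {A : Matrix ι ι ℝ} (hA : ∀ i j, i ≠ j → 0 ≤ A i j) {b : ℝ}
    (hb : 0 ≤ b) {f f' : ℝ → ι → ℝ}
    (hf : ∀ s ∈ Set.Icc 0 b, ∀ i, HasDerivAt (fun x => f x i) (f' s i) s)
    (hsuper : ∀ s ∈ Set.Icc 0 b, ∀ i, (A *ᵥ f s) i ≤ f' s i) (i : ι) :
    (NormedSpace.exp (b • A) *ᵥ f 0) i ≤ f b i := by
  -- Time reversal `s ↦ b - s` turns the forward equation into the backward one.
  have h := exp_smul_mulVec_le hA hb (f := fun s => f (b - s)) (f' := fun s => -f' (b - s))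
    (fun s hs i => by
      have h1 := (hf (b - s) ⟨by linarith [hs.2], by linarith [hs.1]⟩ i).comp s
        ((hasDerivAt_id s).const_sub b)
      rw [mul_neg_one] at h1
      exact h1)
    (fun s hs i => by
      have := hsuper (b - s) ⟨by linarith [hs.2], by linarith [hs.1]⟩ i
      simp only [Pi.neg_apply]
      linarith) i
  simpa using h

/-- The constant vector `exp (ν (s - t))` is a subsolution of the backward equation, as the row sums
of `A` are at least `-ν`; it equals `1` at `s = t`. -/
theorem exp_neg_mul_le_exp_smul_mulVec_one {A : Matrix ι ι ℝ} (hA : ∀ i j, i ≠ j → 0 ≤ A i j)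
    {ν : ℝ} (hν : ∀ i, -(∑ j, A i j) ≤ ν) {t : ℝ} (ht : 0 ≤ t) (i : ι) :
    Real.exp (-(ν * t)) ≤ (NormedSpace.exp (t • A) *ᵥ 1) i := by
  have h := le_exp_smul_mulVec hA ht (f := fun s _ => Real.exp (ν * (s - t)))
    (f' := fun s _ => Real.exp (ν * (s - t)) * ν)
    (fun s _ i => by
      have := (((hasDerivAt_id s).sub_const t).const_mul ν).exp
      simpa using this)
    (fun s _ i => by
      have h2 : (A *ᵥ fun _ => Real.exp (ν * (s - t))) i
          = (∑ j, A i j) * Real.exp (ν * (s - t)) := by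
        rw [Finset.sum_mul]; rfl
      rw [h2]
      nlinarith [hν i, Real.exp_pos (ν * (s - t))]) i
  have e1 : (fun _ : ι => Real.exp (ν * (t - t))) = 1 := by ext; simp
  rw [e1, sub_zero] at h
  calc _ = Real.exp (ν * (0 - t)) := by ring_nf
    _ ≤ _ := h

end Comparison

/-! ### Partial sums of the exponential series -/

/-- The partial sum `∑_{k < d} (σ t)^k / k!` of the exponential series. -/
noncomputable def expPartialSum (σ : ℝ) (d : ℕ) (t : ℝ) : ℝ :=
  ∑ k ∈ Finset.range d, (σ * t) ^ k / (k.factorial : ℝ)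

theorem hasDerivAt_expPartialSum_succ (σ : ℝ) (d : ℕ) (t : ℝ) :
    HasDerivAt (expPartialSum σ (d + 1)) (σ * expPartialSum σ d t) t := by
  induction d with
  | zero =>
    have h : expPartialSum σ (0 + 1) = fun _ => (1 : ℝ) := by
      funext t; simp [expPartialSum]
    rw [h]
    simpa [expPartialSum] using hasDerivAt_const t (1 : ℝ)
  | succ d ih =>
    have h : expPartialSum σ (d + 1 + 1) = fun t => expPartialSum σ (d + 1) t
        + (σ * t) ^ (d + 1) / ((d + 1).factorial : ℝ) := by
      funext t; simp [expPartialSum, Finset.sum_range_succ]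
    rw [h]
    have h2 : HasDerivAt (fun t : ℝ => (σ * t) ^ (d + 1) / ((d + 1).factorial : ℝ))
        (((d + 1 : ℕ) : ℝ) * (σ * t) ^ d * σ / ((d + 1).factorial : ℝ)) t := by
      have := (((hasDerivAt_id t).const_mul σ).pow (d + 1)).div_const ((d + 1).factorial : ℝ)
      simpa using this
    refine (ih.add h2).congr_deriv ?_
    rw [expPartialSum, expPartialSum, Finset.sum_range_succ, Nat.factorial_succ]
    have : ((d : ℝ) + 1) ≠ 0 := by positivity
    have : (d.factorial : ℝ) ≠ 0 := by positivity
    push_cast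
    field_simp

theorem expPartialSum_zero_right (σ : ℝ) (d : ℕ) : expPartialSum σ (d + 1) 0 = 1 := by
  simp [expPartialSum, Finset.sum_range_succ']

theorem continuous_expPartialSum (σ : ℝ) (d : ℕ) : Continuous (expPartialSum σ d) := by
  unfold expPartialSum
  fun_prop

theorem expPartialSum_mono {σ t : ℝ} (hσ : 0 ≤ σ) (ht : 0 ≤ t) {d p : ℕ} (h : d ≤ p) :
    expPartialSum σ d t ≤ expPartialSum σ p t :=
  Finset.sum_le_sum_of_subset_of_nonneg (Finset.range_mono h) fun _ _ _ => by positivity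

/-! ### Growth of `exp (t M) 1` by deletion of states -/

section Growth

variable {ι : Type*} [Fintype ι] [DecidableEq ι]

theorem sum_subtype_ne_add (i : ι) (f : ι → ℝ) : ∑ j : {j // j ≠ i}, f j + f i = ∑ j, f j := by
  rw [← Finset.sum_subtype (Finset.univ.erase i) (by simp) f]
  exact Finset.sum_erase_add _ _ (Finset.mem_univ i)

/-- If one coordinate of `exp (t M) 1` stays below `1`, the other ones are controlled by the growth
of the principal submatrix obtained by deleting that coordinate. -/
theorem exp_smul_mulVec_one_le_of_delete {M : Matrix ι ι ℝ} (hM : ∀ i j, i ≠ j → 0 ≤ M i j)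
    {σ : ℝ} (h1 : ∀ i, ∑ j, M i j ≤ σ) (i : ι)
    (hi : ∀ t : ℝ, 0 ≤ t → (NormedSpace.exp (t • M) *ᵥ 1) i ≤ 1) {t : ℝ} (ht : 0 ≤ t)
    (j : {j // j ≠ i}) :
    (NormedSpace.exp (t • M) *ᵥ 1) j ≤ 1 + σ * ∫ s in (0 : ℝ)..t,
      (NormedSpace.exp (s • M.submatrix (Subtype.val : {j // j ≠ i} → ι)
        (Subtype.val : {j // j ≠ i} → ι)) *ᵥ 1) j := by
  set M' : Matrix {j // j ≠ i} {j // j ≠ i} ℝ := M.submatrix Subtype.val Subtype.val with hM'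
  set b : ℝ → {j // j ≠ i} → ℝ := fun s => NormedSpace.exp (s • M') *ᵥ 1 with hb
  have hMet : ∀ k l, k ≠ l → 0 ≤ M' k l := fun k l h => hM _ _ fun h' => h (Subtype.ext h')
  have hbd : ∀ s k, HasDerivAt (fun x => b x k) ((M' *ᵥ b s) k) s :=
    fun s k => hasDerivAt_exp_smul_mulVec M' 1 s k
  have hbc : ∀ k, Continuous fun x => b x k :=
    fun k => continuous_iff_continuousAt.2 fun s => (hbd s k).continuousAt
  have hb0 : b 0 = 1 := by simp [hb]
  have hint : ∀ s k, (M' *ᵥ fun l => ∫ x in (0 : ℝ)..s, b x l) k = b s k - 1 := by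
    intro s k
    have e1 : ∫ x in (0 : ℝ)..s, (M' *ᵥ b x) k = b s k - b 0 k :=
      intervalIntegral.integral_eq_sub_of_hasDerivAt (fun x _ => hbd x k) (by
        refine Continuous.intervalIntegrable ?_ _ _
        exact continuous_finsetSum _ fun l _ => continuous_const.mul (hbc l))
    have e2 : ∫ x in (0 : ℝ)..s, (M' *ᵥ b x) k = ∑ l, M' k l * ∫ x in (0 : ℝ)..s, b x l := by
      simp only [Matrix.mulVec, dotProduct]
      rw [intervalIntegral.integral_finsetSum (f := fun l x => M' k l * b x l)
        fun l _ => (continuous_const.mul (hbc l)).intervalIntegrable _ _]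
      simp
    rw [hb0] at e1
    rw [← Pi.one_apply (M := fun _ => ℝ) k, ← e1, e2]
    rfl
  set a : ℝ → ι → ℝ := fun s => NormedSpace.exp (s • M) *ᵥ 1 with ha
  have had : ∀ s k, HasDerivAt (fun x => a x k) ((M *ᵥ a s) k) s :=
    fun s k => hasDerivAt_exp_smul_mulVec M 1 s k
  have hrow : ∀ s (k : {j // j ≠ i}), (M *ᵥ a s) k =
      (M' *ᵥ fun l => a s l) k + M k i * a s i :=
    fun s k => (sum_subtype_ne_add i fun l => M k l * a s l).symm
  have hrow1 : ∀ k : {j // j ≠ i}, ∑ l, M k l = ∑ l, M' k l + M k i :=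
    fun k => (sum_subtype_ne_add i fun l => M k l).symm
  -- Let `f = 1 + σ ∫ b - a` on the remaining coordinates. By `hint`, `f' - M' f` equals `σ` minus
  -- the row sum of `M'` minus `M k i * a i`; this is nonnegative because `a i ≤ 1` and the rows of
  -- `M` sum to at most `σ`. Since `f 0 = 0`, `f` stays nonnegative.
  have key := exp_smul_mulVec_le_of_forward hMet ht
    (f := fun s k => 1 + σ * (∫ x in (0 : ℝ)..s, b x k) - a s k)
    (f' := fun s k => σ * b s k - (M *ᵥ a s) k)
    (fun s _ k => by
      have := (((hbc k).integral_hasStrictDerivAt 0 s).hasDerivAt.const_mul σ).const_add 1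
      exact this.sub (had s k))
    (fun s hs k => by
      have e : (M' *ᵥ fun k => 1 + σ * (∫ x in (0 : ℝ)..s, b x k) - a s k) k
          = ∑ l, M' k l + σ * (M' *ᵥ fun l => ∫ x in (0 : ℝ)..s, b x l) k
            - (M' *ᵥ fun l => a s l) k := by
        simp only [Matrix.mulVec, dotProduct]
        rw [Finset.mul_sum, ← Finset.sum_add_distrib, ← Finset.sum_sub_distrib]
        exact Finset.sum_congr rfl fun l _ => by ring
      rw [e, hint, hrow]
      have h3 := h1 k
      rw [hrow1 k] at h3
      have h4 := mul_le_mul_of_nonneg_left (hi s hs.1) (hM k i k.2)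
      change M k i * a s i ≤ _ at h4
      linarith) j
  have z : (fun k : {j // j ≠ i} => 1 + σ * (∫ x in (0 : ℝ)..0, b x k) - a 0 k) = 0 := by
    ext k; simp [ha]
  rw [z, Matrix.mulVec_zero, Pi.zero_apply] at key
  linarith

/-- The vector `v` provides one coordinate that stays below `1`. Deleting it preserves all
hypotheses, and the integration that it costs is exactly what passes from `expPartialSum σ d` to
`expPartialSum σ (d + 1)`. -/
theorem exp_smul_mulVec_one_le_expPartialSum {σ : ℝ} (hσ : 0 ≤ σ) (d : ℕ) :
    ∀ {ι : Type} [Fintype ι] [DecidableEq ι] (_ : Fintype.card ι = d) (M : Matrix ι ι ℝ)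
      (_ : ∀ i j, i ≠ j → 0 ≤ M i j) (_ : ∀ i, ∑ j, M i j ≤ σ) (v : ι → ℝ) (_ : ∀ i, 0 < v i)
      (_ : ∀ i, (M *ᵥ v) i ≤ 0) (t : ℝ) (_ : 0 ≤ t) (i : ι),
      (NormedSpace.exp (t • M) *ᵥ 1) i ≤ expPartialSum σ d t := by
  induction d with
  | zero =>
    intro ι _ _ hd M _ _ v _ _ t _ i
    exact ((Fintype.card_eq_zero_iff.1 hd).false i).elim
  | succ d ih =>
    intro ι _ _ hd M hM h1 v hv hMv t ht i'
    have : Nonempty ι := ⟨i'⟩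
    -- From `v i • 1 ≤ v` and `exp (t M) v ≤ v` follows `v i * (exp (t M) 1) i ≤ v i`.
    obtain ⟨i, hmin⟩ := Finite.exists_min v
    have hP1 : ∀ t : ℝ, 0 ≤ t → 1 ≤ expPartialSum σ (d + 1) t := fun t ht => by
      have := expPartialSum_mono hσ ht (Nat.le_add_left 1 d)
      simpa [expPartialSum] using this
    have hi : ∀ t : ℝ, 0 ≤ t → (NormedSpace.exp (t • M) *ᵥ 1) i ≤ 1 := by
      intro t ht
      have hv' := exp_smul_mulVec_le hM ht (f := fun _ => v) (f' := fun _ _ => 0)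
        (fun s _ k => hasDerivAt_const s (v k)) (fun s _ k => by simpa using hMv k) i
      rw [sub_zero] at hv'
      have h2 : (NormedSpace.exp (t • M) *ᵥ (v i • 1)) i ≤ (NormedSpace.exp (t • M) *ᵥ v) i :=
        exp_smul_mulVec_mono hM ht (fun k => by simpa using hmin k) i
      rw [Matrix.mulVec_smul, Pi.smul_apply, smul_eq_mul] at h2
      by_contra! hcon
      nlinarith [hv i]
    by_cases hj : i' = i
    · subst hj
      exact (hi t ht).trans (hP1 t ht)
    · refine (exp_smul_mulVec_one_le_of_delete hM h1 i hi ht ⟨i', hj⟩).trans ?_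
      set M' : Matrix {j // j ≠ i} {j // j ≠ i} ℝ :=
        M.submatrix Subtype.val Subtype.val with hM'
      have hle : ∀ s, 0 ≤ s → (NormedSpace.exp (s • M') *ᵥ 1) ⟨i', hj⟩ ≤ expPartialSum σ d s := by
        intro s hs
        refine ih (by simp [Fintype.card_subtype_compl, hd]) M'
          (fun k l h => hM _ _ fun h' => h (Subtype.ext h')) (fun k => ?_) (fun k => v k)
          (fun k => hv k) (fun k => ?_) s hs _
        -- The deleted entry `M k i` is nonnegative, so the row sums and the coordinates of `M v`
        -- can only decrease.
        · have := sum_subtype_ne_add i fun l => M k l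
          have h2 := hM k i k.2
          have h3 := h1 k
          have h4 : ∑ l, M' k l = ∑ l : {j // j ≠ i}, M k l := rfl
          linarith
        · have := sum_subtype_ne_add i fun l => M k l * v l
          have h2 := mul_nonneg (hM k i k.2) (hv i).le
          have h3 := hMv k
          have h4 : (M' *ᵥ fun l => v l) k = ∑ l : {j // j ≠ i}, M k l * v l := rfl
          have h5 : (M *ᵥ v) k = ∑ l, M k l * v l := rfl
          linarith
      have hd1 : expPartialSum σ (d + 1) t = 1 + σ * ∫ s in (0 : ℝ)..t, expPartialSum σ d s := by
        rw [← intervalIntegral.integral_const_mul,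
          intervalIntegral.integral_eq_sub_of_hasDerivAt
            (fun s _ => hasDerivAt_expPartialSum_succ σ d s)
            ((continuous_const.mul (continuous_expPartialSum σ d)).intervalIntegrable _ _),
          expPartialSum_zero_right]
        ring
      rw [hd1]
      have hc : Continuous fun s : ℝ => (NormedSpace.exp (s • M') *ᵥ 1) ⟨i', hj⟩ :=
        continuous_iff_continuousAt.2 fun s => (hasDerivAt_exp_smul_mulVec M' 1 s _).continuousAt
      have := intervalIntegral.integral_mono_on (μ := volume) ht (hc.intervalIntegrable 0 t)
        ((continuous_expPartialSum σ d).intervalIntegrable 0 t) fun s hs => hle s hs.1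
      nlinarith

end Growth

/-! ### Positive vectors from the resolvent, and the Erlang bound -/

/-- The witness is `v s = (s I - A)⁻¹ 1`. It is nonnegative for `s > 0` since the row sums of `A`
are at most `0`. Down to `-σ` its smallest coordinate is continuous in `s` and never vanishes, so it
stays positive. -/
theorem exists_pos_mulVec_le {d : ℕ} {A : Matrix (Fin d) (Fin d) ℝ}
    (hA : ∀ i j, i ≠ j → 0 ≤ A i j) (h1 : ∀ i, ∑ j, A i j ≤ 0) {σ : ℝ}
    (hdet : ∀ s, -σ < s → (s • (1 : Matrix (Fin d) (Fin d) ℝ) - A).det ≠ 0) {s : ℝ} (hs : -σ < s) :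
    ∃ v : Fin d → ℝ, (∀ i, 0 < v i) ∧
      ∀ i, ((A - s • (1 : Matrix (Fin d) (Fin d) ℝ)) *ᵥ v) i ≤ 0 := by
  classical
  set R : ℝ → Matrix (Fin d) (Fin d) ℝ := fun s => s • (1 : Matrix (Fin d) (Fin d) ℝ) - A with hR
  set v : ℝ → Fin d → ℝ := fun s => (R s)⁻¹ *ᵥ 1 with hv
  have hRv : ∀ s, -σ < s → R s *ᵥ v s = 1 := fun s hs => by
    rw [hv, Matrix.mulVec_mulVec, Matrix.mul_nonsing_inv _ (hdet s hs).isUnit, Matrix.one_mulVec]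
  have hrow : ∀ s i, (R s *ᵥ v s) i = s * v s i - ∑ j, A i j * v s j := fun s i => by
    rw [hR, Matrix.sub_mulVec, Pi.sub_apply, Matrix.smul_mulVec, Matrix.one_mulVec]; rfl
  have hcont : ContinuousOn v (Set.Ioi (-σ)) := by
    have hRc : Continuous R := by fun_prop
    have hv2 : v = fun s => ((R s).det)⁻¹ • ((R s).adjugate *ᵥ 1) := by
      funext s
      rw [hv]
      simp only [Matrix.inv_def, Ring.inverse_eq_inv', Matrix.smul_mulVec]
    rw [hv2]
    refine ContinuousOn.smul (hRc.matrix_det.continuousOn.inv₀ fun s hs => hdet s hs) ?_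
    exact (hRc.matrix_adjugate.matrix_mulVec continuous_const).continuousOn
  -- If `v s ≥ 0` vanished at `i`, the `i`-th row of `(s I - A) v = 1` would have a nonpositive left
  -- side.
  have hzero : ∀ s, -σ < s → (∀ i, 0 ≤ v s i) → ∀ i, v s i ≠ 0 := by
    intro s hs h0 i hi
    have h2 := hrow s i
    rw [hRv s hs, hi, Pi.one_apply] at h2
    have : 0 ≤ ∑ j, A i j * v s j := Finset.sum_nonneg fun j _ => by
      by_cases hij : i = j
      · subst hij; rw [hi, mul_zero]
      · exact mul_nonneg (hA i j hij) (h0 j)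
    linarith
  rcases isEmpty_or_nonempty (Fin d) with he | hne
  · exact ⟨0, fun i => he.elim i, fun i => he.elim i⟩
  -- Minimum principle: at a negative minimum `v s i`, row `i` of the equation gives `1 ≤ s * v s i
  -- < 0`.
  have hbig : ∀ s, -σ < s → 0 < s → ∀ i, 0 ≤ v s i := by
    intro s hs hs0
    obtain ⟨i, hmin⟩ := Finite.exists_min (v s)
    by_contra! hcon
    obtain ⟨k, hk⟩ := hcon
    have hvi : v s i < 0 := (hmin k).trans_lt hk
    have h2 := hrow s i
    rw [hRv s hs, Pi.one_apply] at h2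
    have h3 : ∑ j, A i j * v s i ≤ ∑ j, A i j * v s j := Finset.sum_le_sum fun j _ => by
      by_cases hij : i = j
      · subst hij; exact le_rfl
      · exact mul_le_mul_of_nonneg_left (hmin j) (hA i j hij)
    rw [← Finset.sum_mul] at h3
    nlinarith [h1 i]
  set m : ℝ → ℝ := fun s => Finset.univ.inf' Finset.univ_nonempty (v s) with hm
  have hmc : ContinuousOn m (Set.Ioi (-σ)) := by
    have := ContinuousOn.finset_inf'_apply (s := Finset.univ) (t := Set.Ioi (-σ))
      (f := fun i s => v s i) Finset.univ_nonempty
      (fun i _ => (continuousOn_pi.1 hcont) i)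
    exact this
  have hmne : ∀ s, -σ < s → m s ≠ 0 := by
    intro s hs h0
    obtain ⟨i, -, hi⟩ := Finset.exists_mem_eq_inf' Finset.univ_nonempty (v s)
    refine hzero s hs (fun j => ?_) i (hi.symm.trans h0)
    rw [← h0]
    exact Finset.inf'_le _ (Finset.mem_univ j)
  have hpos : ∀ s, -σ < s → 0 < m s := by
    intro s hs
    by_contra! hcon
    have hbs : -σ < max s 1 := hs.trans_le (le_max_left _ _)
    have hb1 : (0 : ℝ) < max s 1 := lt_of_lt_of_le one_pos (le_max_right _ _)
    have hb : 0 ≤ m (max s 1) := Finset.le_inf' _ _ fun i _ => hbig _ hbs hb1 i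
    obtain ⟨x, hx, hx0⟩ := intermediate_value_Icc (le_max_left s 1)
      (hmc.mono fun y hy => lt_of_lt_of_le hs hy.1) ⟨hcon, hb⟩
    exact hmne x (lt_of_lt_of_le hs hx.1) hx0
  refine ⟨v s, fun i => (hpos s hs).trans_le (Finset.inf'_le _ (Finset.mem_univ i)), fun i => ?_⟩
  have : A - s • (1 : Matrix (Fin d) (Fin d) ℝ) = -R s := by rw [hR]; simp
  rw [this, Matrix.neg_mulVec, hRv s hs]
  simp

/-- A real kernel vector of `s I - A` makes `s` an eigenvalue. The spectrum is finite, so a dominant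
eigenvalue exists, and its real part would be at least `s`. -/
theorem det_smul_one_sub_ne_zero {d : ℕ} {A : Matrix (Fin d) (Fin d) ℝ} {σ : ℝ}
    (hA : ∀ z, IsDominantEigenvalue A z → z.re ≤ -σ) {s : ℝ} (hs : -σ < s) :
    (s • (1 : Matrix (Fin d) (Fin d) ℝ) - A).det ≠ 0 := by
  intro hdet
  set T := Matrix.toLin' (A.map Complex.ofReal) with hT
  have hev : Module.End.HasEigenvalue T (s : ℂ) := by
    obtain ⟨v, hv, hv0⟩ := Matrix.exists_mulVec_eq_zero_iff.2 hdet
    refine Module.End.hasEigenvalue_of_hasEigenvector (x := fun i => (v i : ℂ)) ⟨?_, ?_⟩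
    · rw [Module.End.mem_eigenspace_iff]
      ext i
      have h := congrFun hv0 i
      rw [Matrix.sub_mulVec, Pi.sub_apply, Matrix.smul_mulVec, Matrix.one_mulVec,
        Pi.zero_apply, Pi.smul_apply, smul_eq_mul] at h
      rw [hT, Matrix.toLin'_apply, Pi.smul_apply, smul_eq_mul]
      have h2 : ((s * v i - (A *ᵥ v) i : ℝ) : ℂ) = 0 := by rw [h]; simp
      simp only [Matrix.mulVec, dotProduct, Matrix.map_apply] at h2 ⊢
      push_cast at h2
      exact (sub_eq_zero.1 h2).symm
    · intro h
      apply hv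
      ext i
      simpa using congrFun h i
  have hfin : Set.Finite {z : ℂ | Module.End.HasEigenvalue T z} :=
    Module.End.finite_hasEigenvalue T
  obtain ⟨z, hz, hmax⟩ := Set.exists_max_image _ Complex.re hfin ⟨_, hev⟩
  have h1 := hA z ⟨hz, fun w hw => hmax w hw⟩
  have h2 := hmax _ hev
  rw [Complex.ofReal_re] at h2
  linarith

/-- The Erlang bound: among the phase-type distributions of order at most `p` whose dominant
eigenvalue is at most `-σ`, the Erlang distribution is stochastically the largest one. -/
theorem exp_smul_mulVec_one_le_erlang {d p : ℕ} (hdp : d ≤ p) {A : Matrix (Fin d) (Fin d) ℝ}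
    (hA : ∀ i j, i ≠ j → 0 ≤ A i j) (h1 : ∀ i, ∑ j, A i j ≤ 0) {σ : ℝ} (hσ : 0 < σ)
    (hdom : ∀ z, IsDominantEigenvalue A z → z.re ≤ -σ) {t : ℝ} (ht : 0 ≤ t) (i : Fin d) :
    (NormedSpace.exp (t • A) *ᵥ 1) i ≤ Real.exp (-(σ * t)) * expPartialSum σ p t := by
  -- At `s = σ` the resolvent may fail to exist, so the bound is shown for `s < σ` and passes to the
  -- limit by continuity.
  have key : ∀ s, 0 < s → s < σ →
      (NormedSpace.exp (t • A) *ᵥ 1) i ≤ Real.exp (-(s * t)) * expPartialSum s p t := by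
    intro s hs0 hs
    obtain ⟨v, hv, hAv⟩ := exists_pos_mulVec_le hA h1
      (fun _ h => det_smul_one_sub_ne_zero hdom h) (neg_lt_neg hs)
    rw [neg_smul, sub_neg_eq_add] at hAv
    have h2 := exp_smul_mulVec_one_le_expPartialSum hs0.le d (Fintype.card_fin d)
      (A + s • (1 : Matrix (Fin d) (Fin d) ℝ))
      (fun k l h => by simpa [Matrix.one_apply_ne h] using hA k l h)
      (fun k => by
        simp only [Matrix.add_apply, Matrix.smul_apply, Matrix.one_apply, smul_eq_mul,
          Finset.sum_add_distrib, mul_ite, mul_one, mul_zero, Finset.sum_ite_eq, Finset.mem_univ,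
          if_true]
        linarith [h1 k]) v hv hAv t ht i
    rw [exp_smul_add_smul_one, Matrix.smul_mulVec, Pi.smul_apply, smul_eq_mul] at h2
    have h3 := h2.trans (expPartialSum_mono hs0.le ht hdp)
    rw [Real.exp_neg, mul_comm s t]
    exact (le_inv_mul_iff₀ (Real.exp_pos _)).2 h3
  have hc : Continuous fun s : ℝ => Real.exp (-(s * t)) * expPartialSum s p t := by
    unfold expPartialSum
    fun_prop
  refine ge_of_tendsto (hc.continuousAt.tendsto.mono_left nhdsWithin_le_nhds :
    Tendsto _ (𝓝[<] σ) _) ?_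
  filter_upwards [Ioo_mem_nhdsLT hσ] with s hs
  exact key s hs.1 hs.2

/-! ### Stochastic order on the line -/

section StochasticOrder

/-- A lower set is everything or a half-line that may omit its endpoint; the endpoint is harmless
because `μ` has no atoms. -/
theorem measure_lowerSet_le {κ μ : Measure ℝ} [NullSingletonClass μ]
    (h : ∀ a, κ (Set.Iic a) ≤ μ (Set.Iic a)) {S : Set ℝ} (hS : IsLowerSet S) : κ S ≤ μ S := by
  rcases S.eq_empty_or_nonempty with rfl | hne
  · simp
  by_cases hb : BddAbove S
  · have h1 : S ⊆ Set.Iic (sSup S) := fun x hx => le_csSup hb hx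
    have h2 : Set.Iio (sSup S) ⊆ S := fun x hx => by
      obtain ⟨y, hy, hxy⟩ := exists_lt_of_lt_csSup hne hx
      exact hS hxy.le hy
    calc κ S ≤ κ (Set.Iic (sSup S)) := measure_mono h1
      _ ≤ μ (Set.Iic (sSup S)) := h _
      _ = μ (Set.Iio (sSup S)) := (measure_congr Iio_ae_eq_Iic).symm
      _ ≤ μ S := measure_mono h2
  · have : S = Set.univ := by
      refine Set.eq_univ_of_forall fun x => ?_
      obtain ⟨y, hy, hxy⟩ := not_bddAbove_iff.1 hb x
      exact hS hxy.le hy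
    subst this
    exact le_of_tendsto_of_tendsto' (tendsto_measure_Iic_atTop κ) (tendsto_measure_Iic_atTop μ) h

/-- Layer-cake formula: the superlevel sets of an antitone function are lower sets. -/
theorem integral_antitone_le {κ μ : Measure ℝ} [NullSingletonClass μ] [IsFiniteMeasure μ]
    (h : ∀ a, κ (Set.Iic a) ≤ μ (Set.Iic a)) {v : ℝ → ℝ} (hv : Antitone v) (h0 : ∀ x, 0 ≤ v x)
    {C : ℝ} (hC : ∀ x, v x ≤ C) : ∫ x, v x ∂κ ≤ ∫ x, v x ∂μ := by
  have hm := hv.measurable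
  rw [integral_eq_lintegral_of_nonneg_ae (ae_of_all _ h0) hm.aestronglyMeasurable,
    integral_eq_lintegral_of_nonneg_ae (ae_of_all _ h0) hm.aestronglyMeasurable]
  refine ENNReal.toReal_mono ?_ ?_
  · refine ((lintegral_mono fun x => ENNReal.ofReal_le_ofReal (hC x)).trans_lt ?_).ne
    rw [lintegral_const]
    exact ENNReal.mul_lt_top ENNReal.ofReal_lt_top (measure_lt_top _ _)
  · rw [lintegral_eq_lintegral_meas_lt κ (ae_of_all _ h0) hm.aemeasurable,
      lintegral_eq_lintegral_meas_lt μ (ae_of_all _ h0) hm.aemeasurable]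
    exact lintegral_mono fun y => measure_lowerSet_le h fun a b hba ha => lt_of_lt_of_le ha (hv hba)

variable {μ : Measure ℝ} [NullSingletonClass μ] [IsProbabilityMeasure μ]

/-- The measure with density `q` on `[0, R]`. -/
noncomputable def densityMeasure (q : ℝ → ℝ) (R : ℝ) : Measure ℝ :=
  (volume.restrict (Set.Ioc 0 R)).withDensity fun x => ENNReal.ofReal (q x)

theorem densityMeasure_Iic {q : ℝ → ℝ} (hq : Continuous q) (hq0 : ∀ x, 0 ≤ x → 0 ≤ q x) {R : ℝ}
    (a : ℝ) : densityMeasure q R (Set.Iic a) =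
      ENNReal.ofReal (∫ x in (0 : ℝ)..max 0 (min a R), q x) := by
  rw [densityMeasure, withDensity_apply _ measurableSet_Iic, Measure.restrict_restrict
    measurableSet_Iic, intervalIntegral.integral_of_le (le_max_left _ _),
    ofReal_integral_eq_lintegral_ofReal]
  · congr 2
    ext x
    simp only [Set.mem_inter_iff, Set.mem_Iic, Set.mem_Ioc, le_max_iff, le_min_iff]
    constructor
    · rintro ⟨h1, h2, h3⟩; exact ⟨h2, Or.inr ⟨h1, h3⟩⟩
    · rintro ⟨h2, h | ⟨h1, h3⟩⟩
      · linarith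
      · exact ⟨h1, h2, h3⟩
  · exact (hq.intervalIntegrable 0 _).1
  · exact (ae_restrict_iff' measurableSet_Ioc).2 (ae_of_all _ fun x hx => hq0 x hx.1.le)

theorem integral_densityMeasure {q : ℝ → ℝ} (hq : Continuous q) (hq0 : ∀ x, 0 ≤ x → 0 ≤ q x)
    {R : ℝ} (hR : 0 ≤ R) (v : ℝ → ℝ) :
    ∫ x, v x ∂(densityMeasure q R) = ∫ x in (0 : ℝ)..R, q x * v x := by
  rw [densityMeasure, integral_withDensity_eq_integral_toReal_smul₀
    (hq.measurable.ennreal_ofReal.aemeasurable) (ae_of_all _ fun x => ENNReal.ofReal_lt_top),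
    intervalIntegral.integral_of_le hR]
  refine setIntegral_congr_fun measurableSet_Ioc fun x hx => ?_
  simp [ENNReal.toReal_ofReal (hq0 x hx.1.le)]

instance nullSingletonClass_densityMeasure (q : ℝ → ℝ) (R : ℝ) :
    NullSingletonClass (densityMeasure q R) where
  measure_singleton x := withDensity_absolutelyContinuous _ _ (measure_singleton x)

theorem isFiniteMeasure_densityMeasure {q : ℝ → ℝ} (hq : Continuous q)
    (hq0 : ∀ x, 0 ≤ x → 0 ≤ q x) {R : ℝ} (hR : 0 ≤ R) :
    IsFiniteMeasure (densityMeasure q R) := by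
  refine ⟨?_⟩
  have h : Tendsto (fun a => densityMeasure q R (Set.Iic a)) atTop
      (𝓝 (ENNReal.ofReal (∫ x in (0 : ℝ)..R, q x))) := by
    refine tendsto_const_nhds.congr' ?_
    filter_upwards [eventually_ge_atTop R] with a ha
    rw [densityMeasure_Iic hq hq0, min_eq_right ha, max_eq_right hR]
  rw [tendsto_nhds_unique (tendsto_measure_Iic_atTop _) h]
  exact ENNReal.ofReal_lt_top

/-- The argument `max 0 (min a R)` is the one of `densityMeasure_Iic`, so comparing distribution
functions on `[0, ∞)` is enough. -/
theorem restrict_Iic_apply_Iic (hμ : μ (Set.Iio 0) = 0) (R a : ℝ) :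
    μ.restrict (Set.Iic R) (Set.Iic a) = ENNReal.ofReal (μ.real (Set.Iic (max 0 (min a R)))) := by
  rw [Measure.restrict_apply measurableSet_Iic, Set.Iic_inter_Iic, ofReal_measureReal]
  rcases le_total 0 (min a R) with h | h
  · rw [max_eq_right h]
  · rw [max_eq_left h]
    have h0 : μ (Set.Iic 0) = 0 := by rw [← measure_congr Iio_ae_eq_Iic, hμ]
    rw [h0]
    exact measure_mono_null (Set.Iic_subset_Iic.2 h) h0

theorem integral_density_mul_le {q : ℝ → ℝ} (hq : Continuous q) (hq0 : ∀ x, 0 ≤ x → 0 ≤ q x)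
    (hμ : μ (Set.Iio 0) = 0) (h : ∀ a, 0 ≤ a → ∫ x in (0 : ℝ)..a, q x ≤ μ.real (Set.Iic a))
    {v : ℝ → ℝ} (hv : Antitone v) (h0 : ∀ x, 0 ≤ v x) {C : ℝ} (hC : ∀ x, v x ≤ C)
    {R : ℝ} (hR : 0 ≤ R) :
    ∫ x in (0 : ℝ)..R, q x * v x ≤ ∫ x in Set.Iic R, v x ∂μ := by
  rw [← integral_densityMeasure hq hq0 hR]
  refine integral_antitone_le (fun a => ?_) hv h0 hC
  rw [densityMeasure_Iic hq hq0, restrict_Iic_apply_Iic hμ R]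
  exact ENNReal.ofReal_le_ofReal (h _ (le_max_left _ _))

theorem le_integral_density_mul {q : ℝ → ℝ} (hq : Continuous q) (hq0 : ∀ x, 0 ≤ x → 0 ≤ q x)
    (hμ : μ (Set.Iio 0) = 0) (h : ∀ a, 0 ≤ a → μ.real (Set.Iic a) ≤ ∫ x in (0 : ℝ)..a, q x)
    {v : ℝ → ℝ} (hv : Antitone v) (h0 : ∀ x, 0 ≤ v x) {C : ℝ} (hC : ∀ x, v x ≤ C)
    {R : ℝ} (hR : 0 ≤ R) :
    ∫ x in Set.Iic R, v x ∂μ ≤ ∫ x in (0 : ℝ)..R, q x * v x := by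
  rw [← integral_densityMeasure hq hq0 hR]
  have := isFiniteMeasure_densityMeasure hq hq0 hR
  refine integral_antitone_le (fun a => ?_) hv h0 hC
  rw [densityMeasure_Iic hq hq0, restrict_Iic_apply_Iic hμ R]
  exact ENNReal.ofReal_le_ofReal (h _ (le_max_left _ _))

end StochasticOrder

/-! ### Survival probabilities of an i.i.d. random walk -/

section Survival

/-- The probability that the partial sums `t + X₀ + ⋯ + Xⱼ`, `j < m`, of a random walk with step
distribution `μ` stay below the barriers `r (k + j)`. -/
noncomputable def walkSurvival (μ : Measure ℝ) (r : ℕ → ℝ) : ℕ → ℕ → ℝ → ℝ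
  | _, 0, _ => 1
  | k, m + 1, t => ∫ x, (Set.Iic (r k)).indicator (walkSurvival μ r (k + 1) m) (t + x) ∂μ

theorem walkSurvival_succ_eq_setIntegral {μ : Measure ℝ} (r : ℕ → ℝ) (k m : ℕ) (t : ℝ) :
    walkSurvival μ r k (m + 1) t =
      ∫ x in Set.Iic (r k - t), walkSurvival μ r (k + 1) m (t + x) ∂μ := by
  rw [walkSurvival, ← integral_indicator measurableSet_Iic]
  congr 1
  ext x
  by_cases h : t + x ≤ r k
  · rw [Set.indicator_of_mem (Set.mem_Iic.2 h),
      Set.indicator_of_mem (Set.mem_Iic.2 (by linarith : x ≤ r k - t))]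
  · rw [Set.indicator_of_notMem (by simpa using h), Set.indicator_of_notMem (by
      simp only [Set.mem_Iic]; intro h'; exact h (by linarith))]

theorem antitone_indicator_Iic {f : ℝ → ℝ} (hf : Antitone f) (h0 : ∀ x, 0 ≤ f x) (a : ℝ) :
    Antitone ((Set.Iic a).indicator f) := by
  intro x y hxy
  by_cases hy : y ∈ Set.Iic a
  · rw [Set.indicator_of_mem hy, Set.indicator_of_mem (show x ∈ Set.Iic a from hxy.trans hy)]
    exact hf hxy
  · rw [Set.indicator_of_notMem hy]
    exact Set.indicator_nonneg (fun x _ => h0 x) x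

variable {μ : Measure ℝ} [IsProbabilityMeasure μ]

theorem walkSurvival_aux (r : ℕ → ℝ) (m : ℕ) : ∀ k, Antitone (walkSurvival μ r k m) ∧
    ∀ t, 0 ≤ walkSurvival μ r k m t ∧ walkSurvival μ r k m t ≤ 1 := by
  induction m with
  | zero => exact fun k => ⟨fun _ _ _ => le_rfl, fun t => ⟨zero_le_one, le_rfl⟩⟩
  | succ m ih =>
    intro k
    obtain ⟨ha, hb⟩ := ih (k + 1)
    set g := (Set.Iic (r k)).indicator (walkSurvival μ r (k + 1) m) with hg
    have hga : Antitone g := antitone_indicator_Iic ha (fun x => (hb x).1) _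
    have hg0 : ∀ x, 0 ≤ g x := Set.indicator_nonneg fun x _ => (hb x).1
    have hg1 : ∀ x, g x ≤ 1 := fun x =>
      Set.indicator_apply_le' (fun _ => (hb x).2) fun _ => zero_le_one
    have hgi : ∀ t, Integrable (fun x => g (t + x)) μ := fun t =>
      Integrable.of_bound (hga.measurable.comp (measurable_const_add t)).aestronglyMeasurable 1
        (ae_of_all _ fun x => by rw [Real.norm_of_nonneg (hg0 _)]; exact hg1 _)
    refine ⟨fun s t hst => integral_mono (hgi t) (hgi s) fun x => hga (by gcongr),
      fun t => ⟨?_, ?_⟩⟩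
    · exact integral_nonneg fun x => hg0 _
    · have := integral_mono (hgi t) (integrable_const (1 : ℝ)) fun x => hg1 (t + x)
      simp only [integral_const, probReal_univ, one_smul] at this
      exact this

theorem antitone_walkSurvival (r : ℕ → ℝ) (k m : ℕ) : Antitone (walkSurvival μ r k m) :=
  (walkSurvival_aux r m k).1

theorem walkSurvival_nonneg (r : ℕ → ℝ) (k m : ℕ) (t : ℝ) : 0 ≤ walkSurvival μ r k m t :=
  ((walkSurvival_aux r m k).2 t).1

theorem walkSurvival_le_one (r : ℕ → ℝ) (k m : ℕ) (t : ℝ) : walkSurvival μ r k m t ≤ 1 :=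
  ((walkSurvival_aux r m k).2 t).2

/-- The integrand jumps only where `t + x = r k`, a null set of `x`. Continuity is needed to
differentiate `blockSurvival` in its lower limit. -/
theorem continuous_walkSurvival [NullSingletonClass μ] (r : ℕ → ℝ) (m : ℕ) :
    ∀ k, Continuous (walkSurvival μ r k m) := by
  induction m with
  | zero => exact fun k => continuous_const
  | succ m ih =>
    intro k
    refine continuous_iff_continuousAt.2 fun t => ?_
    set g := (Set.Iic (r k)).indicator (walkSurvival μ r (k + 1) m) with hg
    have hga : Antitone g := antitone_indicator_Iic (antitone_walkSurvival r _ _)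
      (walkSurvival_nonneg r _ _) _
    refine continuousAt_of_dominated (bound := fun _ => (1 : ℝ))
      (Eventually.of_forall fun s =>
        (hga.measurable.comp (measurable_const_add s)).aestronglyMeasurable)
      (Eventually.of_forall fun s => ae_of_all _ fun x => ?_) (integrable_const _) ?_
    · rw [Real.norm_of_nonneg (Set.indicator_nonneg (fun x _ => walkSurvival_nonneg r _ _ x) _)]
      exact Set.indicator_apply_le' (fun _ => walkSurvival_le_one r _ _ _) fun _ => zero_le_one
    · have hne : ∀ᵐ x ∂μ, x ≠ r k - t := by
        rw [ae_iff]
        simp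
      filter_upwards [hne] with x hx
      have hx' : t + x ≠ r k := fun h => hx (by linarith)
      have hgc : ContinuousAt g (t + x) := by
        rcases lt_or_gt_of_ne hx' with h | h
        · refine (ih (k + 1)).continuousAt.congr ?_
          filter_upwards [Iio_mem_nhds h] with y hy
          exact (Set.indicator_of_mem (Set.mem_Iic.2 (le_of_lt hy)) _).symm
        · refine (continuousAt_const (y := (0 : ℝ))).congr ?_
          filter_upwards [Ioi_mem_nhds h] with y hy
          exact (Set.indicator_of_notMem (s := Set.Iic (r k))
            (fun h' => not_lt.2 h' (Set.mem_Ioi.1 hy)) _).symm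
      exact ContinuousAt.comp (f := fun s => s + x) hgc (continuous_add_const x).continuousAt

theorem measurableSet_partialSum_le (t : ℝ) (r : ℕ → ℝ) (m : ℕ) :
    MeasurableSet {z : ℕ → ℝ | ∀ j < m, t + ∑ i ∈ Finset.range (j + 1), z i ≤ r j} := by
  have : {z : ℕ → ℝ | ∀ j < m, t + ∑ i ∈ Finset.range (j + 1), z i ≤ r j} =
      ⋂ j, ⋂ (_ : j < m), {z : ℕ → ℝ | t + ∑ i ∈ Finset.range (j + 1), z i ≤ r j} := by
    ext; simp
  rw [this]
  exact MeasurableSet.iInter fun j => MeasurableSet.iInter fun _ =>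
    measurableSet_le (by fun_prop) measurable_const

theorem forall_partialSum_succ_le {t : ℝ} {r : ℕ → ℝ} {m : ℕ} {z : ℕ → ℝ} :
    (∀ j < m + 1, t + ∑ i ∈ Finset.range (j + 1), z i ≤ r j) ↔
      t + z 0 ≤ r 0 ∧ ∀ j < m, (t + z 0) + ∑ i ∈ Finset.range (j + 1), z (i + 1) ≤ r (j + 1) := by
  constructor
  · intro h
    refine ⟨by simpa using h 0 (Nat.succ_pos _), fun j hj => ?_⟩
    have := h (j + 1) (by omega)
    rw [Finset.sum_range_succ'] at this
    linarith
  · rintro ⟨h0, h⟩ j hj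
    rcases j with _ | j
    · simpa using h0
    · rw [Finset.sum_range_succ']
      linarith [h j (by omega)]

/-- The survival probability of an i.i.d. random walk. -/
theorem measure_partialSum_le_eq_walkSurvival {Ω : Type*} [MeasurableSpace Ω] {P : Measure Ω}
    [IsProbabilityMeasure P] {H : ℕ → Ω → ℝ} (hlaw : ∀ k, HasLaw (H k) μ P) (hH : iIndepFun H P)
    (r : ℕ → ℝ) (m : ℕ) : ∀ (k : ℕ) (t : ℝ),
    P {ω | ∀ j < m, t + ∑ i ∈ Finset.range (j + 1), H (k + i) ω ≤ r (k + j)} =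
      ENNReal.ofReal (walkSurvival μ r k m t) := by
  induction m with
  | zero => intro k t; simp [walkSurvival]
  | succ m ih =>
    intro k t
    -- Only the `m` steps after `k` matter; padding with zeros makes `Z` a function of finitely many
    -- claims, hence independent of `H k`.
    set Z : Ω → ℕ → ℝ := fun ω i => if i < m then H (k + 1 + i) ω else 0 with hZ
    have hZm : AEMeasurable Z P := aemeasurable_pi_iff.2 fun i => by
      by_cases hi : i < m
      · simpa [hZ, hi] using (hlaw (k + 1 + i)).aemeasurable
      · simp [hZ, hi]
    have hind : IndepFun (H k) Z P := by
      have h := hH.indepFun_finset₀ {k} (Finset.Ico (k + 1) (k + 1 + m)) (by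
        rw [Finset.disjoint_left]; intro a; simp only [Finset.mem_singleton, Finset.mem_Ico]; omega)
        fun i => (hlaw i).aemeasurable
      have h2 := h.comp (φ := fun z => z ⟨k, Finset.mem_singleton_self k⟩)
        (ψ := fun (z : Finset.Ico (k + 1) (k + 1 + m) → ℝ) i =>
          if hi : i < m then z ⟨k + 1 + i, by simp; omega⟩ else 0)
        (measurable_pi_apply (X := fun _ => ℝ) _) (measurable_pi_lambda _ fun i => by
          by_cases hi : i < m
          · simp only [hi, dif_pos]
            fun_prop
          · simp [hi])
      refine h2.congr (ae_of_all _ fun ω => rfl) (ae_of_all _ fun ω => ?_)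
      funext i
      simp [hZ]
    have hmap := (indepFun_iff_map_prod_eq_prod_map_map (hlaw k).aemeasurable hZm).1 hind
    have : IsProbabilityMeasure (P.map Z) := Measure.isProbabilityMeasure_map hZm
    set B : Set (ℝ × (ℕ → ℝ)) := {q | t + q.1 ≤ r k ∧
      ∀ j < m, (t + q.1) + ∑ i ∈ Finset.range (j + 1), q.2 i ≤ r (k + 1 + j)} with hB
    have hBm : MeasurableSet B := by
      have : B = {q | t + q.1 ≤ r k} ∩ ⋂ j, ⋂ (_ : j < m), {q : ℝ × (ℕ → ℝ) |
          (t + q.1) + ∑ i ∈ Finset.range (j + 1), q.2 i ≤ r (k + 1 + j)} := by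
        ext; simp [hB]
      rw [this]
      refine (measurableSet_le (by fun_prop) measurable_const).inter ?_
      exact MeasurableSet.iInter fun j => MeasurableSet.iInter fun _ =>
        measurableSet_le (by fun_prop) measurable_const
    have hset : {ω | ∀ j < m + 1, t + ∑ i ∈ Finset.range (j + 1), H (k + i) ω ≤ r (k + j)} =
        (fun ω => (H k ω, Z ω)) ⁻¹' B := by
      ext ω
      simp only [Set.mem_ofPred_eq, Set.mem_preimage, hB]
      rw [forall_partialSum_succ_le (z := fun i => H (k + i) ω) (r := fun j => r (k + j))]
      refine and_congr Iff.rfl (forall₂_congr fun j hj => ?_)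
      have e : ∑ i ∈ Finset.range (j + 1), H (k + (i + 1)) ω
          = ∑ i ∈ Finset.range (j + 1), Z ω i := by
        refine Finset.sum_congr rfl fun i hi => ?_
        have : i < m := by rw [Finset.mem_range] at hi; omega
        simp only [hZ, this, if_true]
        congr 1
        omega
      rw [e, show k + (j + 1) = k + 1 + j by omega]
      simp
    rw [hset, ← Measure.map_apply_of_aemeasurable ((hlaw k).aemeasurable.prodMk hZm) hBm, hmap,
      Measure.prod_apply hBm, (hlaw k).map_eq, walkSurvival,
      ofReal_integral_eq_lintegral_ofReal]
    · refine lintegral_congr fun x => ?_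
      by_cases hx : t + x ≤ r k
      · rw [Set.indicator_of_mem (Set.mem_Iic.2 hx), ← ih (k + 1) (t + x)]
        have hs : Prod.mk x ⁻¹' B = {z : ℕ → ℝ |
            ∀ j < m, (t + x) + ∑ i ∈ Finset.range (j + 1), z i ≤ r (k + 1 + j)} := by
          ext z; simp [hB, hx]
        rw [hs, Measure.map_apply_of_aemeasurable hZm
          (measurableSet_partialSum_le (t + x) (fun j => r (k + 1 + j)) m)]
        congr 1
        ext ω
        refine forall₂_congr fun j hj => ?_
        have e : ∑ i ∈ Finset.range (j + 1), Z ω i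
            = ∑ i ∈ Finset.range (j + 1), H (k + 1 + i) ω := by
          refine Finset.sum_congr rfl fun i hi => ?_
          have : i < m := by rw [Finset.mem_range] at hi; omega
          simp only [hZ, this, if_true]
        rw [e]
      · rw [Set.indicator_of_notMem (by simpa using hx)]
        have hs : Prod.mk x ⁻¹' B = ∅ := by
          ext z; simp [hB, hx]
        rw [hs]; simp
    · have hga : Antitone ((Set.Iic (r k)).indicator (walkSurvival μ r (k + 1) m)) :=
        antitone_indicator_Iic (antitone_walkSurvival r _ _) (walkSurvival_nonneg r _ _) _
      refine Integrable.of_bound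
        (hga.measurable.comp (measurable_const_add t)).aestronglyMeasurable 1
        (ae_of_all _ fun x => ?_)
      rw [Real.norm_of_nonneg (Set.indicator_nonneg (fun x _ => walkSurvival_nonneg r _ _ x) _)]
      exact Set.indicator_apply_le' (fun _ => walkSurvival_le_one r _ _ _) fun _ => zero_le_one
    · exact ae_of_all _ fun x => Set.indicator_nonneg (fun x _ => walkSurvival_nonneg r _ _ x) _

end Survival

/-! ### Distribution function of the Erlang law -/

section Gamma

/-- In the product rule the two sums telescope, and only the top term, the Erlang density, survives.
-/
theorem hasDerivAt_exp_mul_expPartialSum (σ : ℝ) (d : ℕ) (x : ℝ) :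
    HasDerivAt (fun x => -(Real.exp (-(σ * x)) * expPartialSum σ (d + 1) x))
      (σ ^ (d + 1) / (d.factorial : ℝ) * x ^ d * Real.exp (-(σ * x))) x := by
  have h1 : HasDerivAt (fun x : ℝ => Real.exp (-(σ * x))) (Real.exp (-(σ * x)) * -σ) x := by
    simpa using (((hasDerivAt_id x).const_mul σ).neg).exp
  refine (h1.mul (hasDerivAt_expPartialSum_succ σ d x)).neg.congr_deriv ?_
  rw [expPartialSum, Finset.sum_range_succ, ← expPartialSum]
  ring

theorem gammaMeasure_real_Iic {p : ℕ} (hp : 0 < p) {σ : ℝ} (hσ : 0 < σ) {a : ℝ} (ha : 0 ≤ a) :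
    (gammaMeasure p σ).real (Set.Iic a) = 1 - Real.exp (-(σ * a)) * expPartialSum σ p a := by
  obtain ⟨d, rfl⟩ : ∃ d, p = d + 1 := ⟨p - 1, by omega⟩
  have hp' : (0 : ℝ) < ((d + 1 : ℕ) : ℝ) := by positivity
  have := isProbabilityMeasure_gammaMeasure hp' hσ
  rw [← cdf_eq_real, cdf_gammaMeasure_eq_integral hp' hσ]
  have e1 : ∫ x in Set.Iic a, gammaPDFReal ((d + 1 : ℕ) : ℝ) σ x
      = ∫ x in (0 : ℝ)..a, σ ^ (d + 1) / (d.factorial : ℝ) * x ^ d * Real.exp (-(σ * x)) := by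
    rw [intervalIntegral.integral_of_le ha, ← integral_indicator measurableSet_Iic,
      ← integral_indicator measurableSet_Ioc]
    refine integral_congr_ae ?_
    have hne : ∀ᵐ x : ℝ, x ≠ 0 := by rw [ae_iff]; simp
    filter_upwards [hne] with x hx0
    by_cases hxa : x ≤ a
    · rw [Set.indicator_of_mem (Set.mem_Iic.2 hxa)]
      rcases lt_or_gt_of_ne hx0 with h | h
      · rw [Set.indicator_of_notMem (fun h' => not_lt.2 h.le h'.1), gammaPDFReal,
          if_neg (not_le.2 h)]
      · rw [Set.indicator_of_mem (Set.mem_Ioc.2 ⟨h, hxa⟩), gammaPDFReal, if_pos h.le]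
        have e2 : (((d + 1 : ℕ) : ℝ) - 1) = (d : ℝ) := by push_cast; ring
        rw [e2, Real.rpow_natCast, Real.rpow_natCast]
        have e3 : Real.Gamma ((d + 1 : ℕ) : ℝ) = d.factorial := by
          rw [← Real.Gamma_nat_eq_factorial]; push_cast; rfl
        rw [e3]
    · rw [Set.indicator_of_notMem (by simpa using hxa),
        Set.indicator_of_notMem (fun h' => hxa h'.2)]
  rw [e1, intervalIntegral.integral_eq_sub_of_hasDerivAt
    (fun x _ => hasDerivAt_exp_mul_expPartialSum σ d x)
    (by apply Continuous.intervalIntegrable; fun_prop), expPartialSum_zero_right]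
  simp
  ring

instance nullSingletonClass_gammaMeasure (a r : ℝ) : NullSingletonClass (gammaMeasure a r) where
  measure_singleton x := withDensity_absolutelyContinuous _ _ (measure_singleton x)

theorem gammaMeasure_Iio_zero (a r : ℝ) : gammaMeasure a r (Set.Iio 0) = 0 := by
  rw [gammaMeasure, withDensity_apply _ measurableSet_Iio]
  exact lintegral_gammaPDF_of_nonpos le_rfl

end Gamma

/-! ### One phase-type block followed by an i.i.d. walk -/

section Block

variable {ι : Type*} [Fintype ι] [DecidableEq ι]

/-- `blockSurvival A d w r t i` is `∫ₜʳ (exp ((x - t) A) d)ᵢ w x dx`: the probability that a block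
with rates `A` and exit rates `d`, entered in the state `i` at time `t`, is left before time `r`
and that the survival of probability `w` occurs afterwards. -/
noncomputable def blockSurvival (A : Matrix ι ι ℝ) (d : ι → ℝ) (w : ℝ → ℝ) (r t : ℝ) : ι → ℝ :=
  NormedSpace.exp ((-t) • A) *ᵥ fun j => ∫ x in t..r, (NormedSpace.exp (x • A) *ᵥ d) j * w x

theorem blockSurvival_self (A : Matrix ι ι ℝ) (d : ι → ℝ) (w : ℝ → ℝ) (r : ℝ) :
    blockSurvival A d w r r = 0 := by
  have : (fun j => ∫ x in r..r, (NormedSpace.exp (x • A) *ᵥ d) j * w x) = 0 := by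
    ext; simp
  rw [blockSurvival, this, Matrix.mulVec_zero]

theorem continuous_exp_smul_mulVec (A : Matrix ι ι ℝ) (d : ι → ℝ) (i : ι) :
    Continuous fun x : ℝ => (NormedSpace.exp (x • A) *ᵥ d) i :=
  continuous_iff_continuousAt.2 fun s => (hasDerivAt_exp_smul_mulVec A d s i).continuousAt

/-- The backward equation with source `d w`. The form of `blockSurvival`, with `exp (-t A)` outside
the integral, reduces it to the product rule. -/
theorem hasDerivAt_blockSurvival (A : Matrix ι ι ℝ) (d : ι → ℝ) {w : ℝ → ℝ} (hw : Continuous w)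
    (r t : ℝ) (i : ι) :
    HasDerivAt (fun s => blockSurvival A d w r s i)
      (-(A *ᵥ blockSurvival A d w r t) i - d i * w t) t := by
  have hJ : ∀ j, HasDerivAt (fun s => ∫ x in s..r, (NormedSpace.exp (x • A) *ᵥ d) j * w x)
      (-((NormedSpace.exp (t • A) *ᵥ d) j * w t)) t := fun j => by
    have hc : Continuous fun x : ℝ => (NormedSpace.exp (x • A) *ᵥ d) j * w x :=
      (continuous_exp_smul_mulVec A d j).mul hw
    exact intervalIntegral.integral_hasDerivAt_left (hc.intervalIntegrable _ _)
      (hc.stronglyMeasurableAtFilter _ _) hc.continuousAt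
  have h := hasDerivAt_exp_sub_smul_mulVec (-A) 0 t
    (f := fun s j => ∫ x in s..r, (NormedSpace.exp (x • A) *ᵥ d) j * w x)
    (f' := fun t j => -((NormedSpace.exp (t • A) *ᵥ d) j * w t)) hJ i
  simp only [sub_zero, smul_neg, ← neg_smul] at h
  refine h.congr_deriv ?_
  have e : (fun j => -((NormedSpace.exp (t • A) *ᵥ d) j * w t))
      = (-w t) • (NormedSpace.exp (t • A) *ᵥ d) := by
    ext j; simp; ring
  rw [Matrix.mulVec_add, e, Matrix.mulVec_smul, Matrix.mulVec_mulVec d, ← exp_add_smul,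
    neg_add_cancel, zero_smul, NormedSpace.exp_zero, Matrix.one_mulVec, Matrix.neg_mulVec,
    Matrix.mulVec_neg, Matrix.mulVec_mulVec, ← commute_exp_smul, ← Matrix.mulVec_mulVec]
  simp only [blockSurvival, Pi.add_apply, Pi.neg_apply, Pi.smul_apply, smul_eq_mul]
  ring

theorem blockSurvival_eq_integral (A : Matrix ι ι ℝ) (d : ι → ℝ) {w : ℝ → ℝ} (hw : Continuous w)
    (r t : ℝ) (i : ι) : blockSurvival A d w r t i =
      ∫ x in (0 : ℝ)..(r - t), (NormedSpace.exp (x • A) *ᵥ d) i * w (t + x) := by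
  have h1 : ∫ x in (0 : ℝ)..(r - t), (NormedSpace.exp (x • A) *ᵥ d) i * w (t + x)
      = ∫ x in t..r, (NormedSpace.exp ((x - t) • A) *ᵥ d) i * w x := by
    have := intervalIntegral.integral_comp_add_left (a := 0) (b := r - t)
      (fun x => (NormedSpace.exp ((x - t) • A) *ᵥ d) i * w x) t
    simpa using this
  have h2 : ∀ x, (NormedSpace.exp ((x - t) • A) *ᵥ d) i * w x =
      ∑ j, NormedSpace.exp ((-t) • A) i j * ((NormedSpace.exp (x • A) *ᵥ d) j * w x) := by
    intro x
    rw [sub_eq_neg_add, exp_add_smul, ← Matrix.mulVec_mulVec, Matrix.mulVec, dotProduct,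
      Finset.sum_mul]
    exact Finset.sum_congr rfl fun j _ => by ring
  rw [h1]
  simp only [h2]
  rw [intervalIntegral.integral_finsetSum (f := fun j x => NormedSpace.exp ((-t) • A) i j *
    ((NormedSpace.exp (x • A) *ᵥ d) j * w x)) fun j _ => (continuous_const.mul
      ((continuous_exp_smul_mulVec A d j).mul hw)).intervalIntegrable _ _]
  simp only [intervalIntegral.integral_const_mul]
  rfl

/-- Because `d = -A 1`, the integrand is the derivative of `-exp (x A) 1`: the exit density
integrates to one minus the tail. -/
theorem integral_exp_smul_mulVec_exit {A : Matrix ι ι ℝ} {d : ι → ℝ} (hd : A *ᵥ 1 = -d) (a : ℝ)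
    (i : ι) : ∫ x in (0 : ℝ)..a, (NormedSpace.exp (x • A) *ᵥ d) i =
      1 - (NormedSpace.exp (a • A) *ᵥ 1) i := by
  have h : ∀ x : ℝ, (NormedSpace.exp (x • A) *ᵥ d) i =
      -(A *ᵥ (NormedSpace.exp (x • A) *ᵥ 1)) i := by
    intro x
    rw [Matrix.mulVec_mulVec, commute_exp_smul, ← Matrix.mulVec_mulVec, hd, Matrix.mulVec_neg,
      Pi.neg_apply, neg_neg]
  rw [intervalIntegral.integral_eq_sub_of_hasDerivAt
    (f := fun x => -(NormedSpace.exp (x • A) *ᵥ 1) i)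
    (fun x _ => by rw [h]; exact (hasDerivAt_exp_smul_mulVec A 1 x i).neg)
    ((continuous_exp_smul_mulVec A d i).intervalIntegrable _ _)]
  simp
  ring

variable {μ : Measure ℝ} [NullSingletonClass μ] [IsProbabilityMeasure μ]

/-- Both sides integrate the antitone function `x ↦ w (t + x)` up to `r k - t`, against `μ` and
against the exit density; the tail bound orders the two distribution functions. -/
theorem walkSurvival_le_blockSurvival {A : Matrix ι ι ℝ} (hA : ∀ i j, i ≠ j → 0 ≤ A i j)
    {d : ι → ℝ} (hd0 : ∀ i, 0 ≤ d i) (hd : A *ᵥ 1 = -d) (hμ : μ (Set.Iio 0) = 0)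
    (htail : ∀ a, 0 ≤ a → ∀ i, (NormedSpace.exp (a • A) *ᵥ 1) i ≤ 1 - μ.real (Set.Iic a))
    (r : ℕ → ℝ) (k m : ℕ) {t : ℝ} (ht : t ≤ r k) (i : ι) :
    walkSurvival μ r k (m + 1) t ≤ blockSurvival A d (walkSurvival μ r (k + 1) m) (r k) t i := by
  rw [walkSurvival_succ_eq_setIntegral,
    blockSurvival_eq_integral _ _ (continuous_walkSurvival r _ _)]
  refine le_integral_density_mul (continuous_exp_smul_mulVec A d i)
    (fun x hx => exp_smul_mulVec_nonneg hA hx hd0 i) hμ (fun a ha => ?_)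
    (fun x y hxy => antitone_walkSurvival r _ _ (by gcongr))
    (fun x => walkSurvival_nonneg r _ _ _) (fun x => walkSurvival_le_one r _ _ _) (sub_nonneg.2 ht)
  rw [integral_exp_smul_mulVec_exit hd]
  linarith [htail a ha i]

theorem blockSurvival_le_walkSurvival {A : Matrix ι ι ℝ} (hA : ∀ i j, i ≠ j → 0 ≤ A i j)
    {d : ι → ℝ} (hd0 : ∀ i, 0 ≤ d i) (hd : A *ᵥ 1 = -d) (hμ : μ (Set.Iio 0) = 0)
    (htail : ∀ a, 0 ≤ a → ∀ i, 1 - μ.real (Set.Iic a) ≤ (NormedSpace.exp (a • A) *ᵥ 1) i)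
    (r : ℕ → ℝ) (k m : ℕ) {t : ℝ} (ht : t ≤ r k) (i : ι) :
    blockSurvival A d (walkSurvival μ r (k + 1) m) (r k) t i ≤ walkSurvival μ r k (m + 1) t := by
  rw [walkSurvival_succ_eq_setIntegral,
    blockSurvival_eq_integral _ _ (continuous_walkSurvival r _ _)]
  refine integral_density_mul_le (continuous_exp_smul_mulVec A d i)
    (fun x hx => exp_smul_mulVec_nonneg hA hx hd0 i) hμ (fun a ha => ?_)
    (fun x y hxy => antitone_walkSurvival r _ _ (by gcongr))
    (fun x => walkSurvival_nonneg r _ _ _) (fun x => walkSurvival_le_one r _ _ _) (sub_nonneg.2 ht)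
  rw [integral_exp_smul_mulVec_exit hd]
  linarith [htail a ha i]

end Block

/-! ### Finite-dimensional distributions by backward recursion -/

section BackwardSurvival

variable {E : Type*} [Fintype E] [DecidableEq E]

/-- The probability that a Markov jump process with generator `Λ`, in a given state at time `t j`,
is in `B (j + 1), …, B (j + q)` at the times `t (j + 1), …, t (j + q)`. -/
noncomputable def backwardProb (Λ : Matrix E E ℝ) (t : ℕ → ℝ) (B : ℕ → Set E) : ℕ → ℕ → E → ℝ
  | _, 0 => 1
  | j, q + 1 => NormedSpace.exp ((t (j + 1) - t j) • Λ) *ᵥ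
      (B (j + 1)).indicator (backwardProb Λ t B (j + 1) q)

theorem measureReal_fidi_eq_backwardProb {Ω : Type*} [MeasurableSpace Ω] {P : Measure Ω}
    [IsProbabilityMeasure P] {Λ : Matrix E E ℝ} {π₀ : E → ℝ} {φ : ℝ≥0 → Ω → E}
    (h : IsMarkovJumpProcess Λ π₀ φ P) {t : ℕ → ℝ≥0} (ht : Monotone t) (ht0 : t 0 = 0)
    (B : ℕ → Set E) (q : ℕ) : ∀ (j : ℕ) (x : ℕ → E),
    P.real {ω | (∀ i ≤ j, φ (t i) ω = x i) ∧ ∀ i, j < i → i ≤ j + q → φ (t i) ω ∈ B i} =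
      (π₀ (x 0) * ∏ i ∈ Finset.range j,
        NormedSpace.exp (((t (i + 1) : ℝ) - (t i : ℝ)) • Λ) (x i) (x (i + 1))) *
        backwardProb Λ (fun i => t i) B j q (x j) := by
  classical
  induction q with
  | zero =>
    intro j x
    have e : {ω | (∀ i ≤ j, φ (t i) ω = x i) ∧ ∀ i, j < i → i ≤ j + 0 → φ (t i) ω ∈ B i} =
        {ω | ∀ i ≤ j, φ (t i) ω = x i} := by
      ext ω
      simp only [Set.mem_ofPred_eq, and_iff_left_iff_imp]
      intro _ i hi hi'
      omega
    rw [e, h.finite_dim j t x ht ht0]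
    simp [backwardProb]
  | succ q ih =>
    intro j x
    -- The event is split according to the state `y` at time `t (j + 1)`, which extends the
    -- prescribed path `x` by one point.
    set S : E → Set Ω := fun y => {ω | (∀ i ≤ j + 1, φ (t i) ω = Function.update x (j + 1) y i) ∧
      ∀ i, j + 1 < i → i ≤ j + 1 + q → φ (t i) ω ∈ B i} with hS
    have hupd : ∀ y, ∀ i ≤ j, Function.update x (j + 1) y i = x i := fun y i hi =>
      Function.update_of_ne (by omega) _ _
    have e : {ω | (∀ i ≤ j, φ (t i) ω = x i) ∧ ∀ i, j < i → i ≤ j + (q + 1) → φ (t i) ω ∈ B i} =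
        ⋃ y ∈ (Finset.univ.filter fun y => y ∈ B (j + 1)), S y := by
      ext ω
      simp only [Set.mem_ofPred_eq, Set.mem_iUnion, Finset.mem_filter, Finset.mem_univ, true_and,
        hS, exists_prop]
      constructor
      · rintro ⟨h1, h2⟩
        refine ⟨φ (t (j + 1)) ω, h2 (j + 1) (by omega) (by omega), fun i hi => ?_, fun i hi hi' =>
          h2 i (by omega) (by omega)⟩
        rcases Nat.lt_or_ge j i with hji | hji
        · obtain rfl : i = j + 1 := by omega
          simp
        · rw [hupd _ i hji, h1 i hji]
      · rintro ⟨y, hy, h1, h2⟩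
        have h3 := h1 (j + 1) le_rfl
        rw [Function.update_self] at h3
        refine ⟨fun i hi => by rw [h1 i (by omega), hupd _ i hi], fun i hi hi' => ?_⟩
        rcases Nat.lt_or_ge (j + 1) i with hji | hji
        · exact h2 i hji (by omega)
        · obtain rfl : i = j + 1 := by omega
          rw [h3]; exact hy
    have hSm : ∀ y, MeasurableSet (S y) := by
      intro y
      have : S y = (⋂ i, ⋂ (_ : i ≤ j + 1), {ω | φ (t i) ω = Function.update x (j + 1) y i}) ∩
          ⋂ i, ⋂ (_ : j + 1 < i), ⋂ (_ : i ≤ j + 1 + q), ⋃ z ∈ B i, {ω | φ (t i) ω = z} := by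
        ext ω; simp [hS]
      rw [this]
      refine (MeasurableSet.iInter fun i => MeasurableSet.iInter fun _ =>
        h.measurableSet_eq _ _).inter ?_
      exact MeasurableSet.iInter fun i => MeasurableSet.iInter fun _ => MeasurableSet.iInter
        fun _ => MeasurableSet.biUnion (Set.to_countable _) fun z _ => h.measurableSet_eq _ _
    have hdisj : Set.PairwiseDisjoint (↑(Finset.univ.filter fun y => y ∈ B (j + 1))) S := by
      intro y _ y' _ hyy
      refine Set.disjoint_left.2 fun ω hω hω' => hyy ?_
      have h1 := hω.1 (j + 1) le_rfl
      have h2 := hω'.1 (j + 1) le_rfl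
      rw [Function.update_self] at h1 h2
      exact h1.symm.trans h2
    rw [e, measureReal_biUnion_finset hdisj fun y _ => hSm y]
    have hterm : ∀ y, P.real (S y) = (π₀ (x 0) * ∏ i ∈ Finset.range j,
        NormedSpace.exp (((t (i + 1) : ℝ) - (t i : ℝ)) • Λ) (x i) (x (i + 1))) *
        (NormedSpace.exp (((t (j + 1) : ℝ) - (t j : ℝ)) • Λ) (x j) y *
          backwardProb Λ (fun i => t i) B (j + 1) q y) := by
      intro y
      rw [hS, ih (j + 1) (Function.update x (j + 1) y), Finset.prod_range_succ,
        Function.update_self, hupd y 0 (Nat.zero_le _), hupd y j le_rfl]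
      have : ∏ i ∈ Finset.range j, NormedSpace.exp (((t (i + 1) : ℝ) - (t i : ℝ)) • Λ)
          (Function.update x (j + 1) y i) (Function.update x (j + 1) y (i + 1)) =
          ∏ i ∈ Finset.range j, NormedSpace.exp (((t (i + 1) : ℝ) - (t i : ℝ)) • Λ)
            (x i) (x (i + 1)) := by
        refine Finset.prod_congr rfl fun i hi => ?_
        have := Finset.mem_range.1 hi
        rw [hupd y i (by omega), hupd y (i + 1) (by omega)]
      rw [this]
      ring
    rw [Finset.sum_congr rfl fun y _ => hterm y, ← Finset.mul_sum, backwardProb]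
    congr 1
    rw [Matrix.mulVec, dotProduct, Finset.sum_filter]
    refine Finset.sum_congr rfl fun y _ => ?_
    by_cases hy : y ∈ B (j + 1)
    · simp [hy]
    · simp [hy]

theorem measureReal_forall_mem_eq_backwardProb {Ω : Type*} [MeasurableSpace Ω] {P : Measure Ω}
    [IsProbabilityMeasure P] {Λ : Matrix E E ℝ} {π₀ : E → ℝ} {φ : ℝ≥0 → Ω → E}
    (h : IsMarkovJumpProcess Λ π₀ φ P) {t : ℕ → ℝ≥0} (ht : Monotone t) (ht0 : t 0 = 0)
    (B : ℕ → Set E) (q : ℕ) :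
    P.real {ω | ∀ i, 0 < i → i ≤ q → φ (t i) ω ∈ B i} =
      ∑ x, π₀ x * backwardProb Λ (fun i => t i) B 0 q x := by
  classical
  set S : E → Set Ω := fun y => {ω | (∀ i ≤ 0, φ (t i) ω = y) ∧
      ∀ i, 0 < i → i ≤ 0 + q → φ (t i) ω ∈ B i} with hS
  have e : {ω | ∀ i, 0 < i → i ≤ q → φ (t i) ω ∈ B i} = ⋃ y ∈ (Finset.univ : Finset E), S y := by
    ext ω
    simp [hS]
  rw [e, measureReal_biUnion_finset]
  · refine Finset.sum_congr rfl fun y _ => ?_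
    rw [hS, measureReal_fidi_eq_backwardProb h ht ht0 B q 0 fun _ => y]
    simp
  · intro y _ y' _ hyy
    refine Set.disjoint_left.2 fun ω hω hω' => hyy ?_
    exact (hω.1 0 le_rfl).symm.trans (hω'.1 0 le_rfl)
  · intro y _
    have : S y = {ω | φ (t 0) ω = y} ∩
        ⋂ i, ⋂ (_ : 0 < i), ⋂ (_ : i ≤ q), ⋃ z ∈ B i, {ω | φ (t i) ω = z} := by
      ext ω; simp [hS]
    rw [this]
    refine (h.measurableSet_eq _ _).inter ?_
    exact MeasurableSet.iInter fun i => MeasurableSet.iInter fun _ => MeasurableSet.iInter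
      fun _ => MeasurableSet.biUnion (Set.to_countable _) fun z _ => h.measurableSet_eq _ _

end BackwardSurvival

/-! ### The generator acting block by block -/

namespace PhaseTypeRep

variable (M : PhaseTypeRep)

/-- The index of the block of a state; the absorbing state counts as the block `n`. -/
def level {n : ℕ} : M.State n → ℕ
  | none => n
  | some ⟨k, _⟩ => k

/-- The function on the state space which is given by `F k` on the block `k` and takes the value
`c` at the absorbing state. -/
def blockFun (n : ℕ) (F : ∀ k, Fin (M.dim k) → ℝ) (c : ℝ) : M.State n → ℝ
  | none => c
  | some ⟨k, i⟩ => F k i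

/-- The rates of leaving the block `k`. -/
def exitRate (k : ℕ) (i : Fin (M.dim k)) : ℝ := ∑ j, M.D k i j

theorem exitRate_nonneg (k : ℕ) (i : Fin (M.dim k)) : 0 ≤ M.exitRate k i :=
  Finset.sum_nonneg fun j _ => M.D_nonneg k i j

theorem mulVec_one_eq (k : ℕ) : M.A k *ᵥ 1 = -M.exitRate k := by
  ext i
  have := M.row_sum k i
  simp only [Matrix.mulVec, dotProduct, Pi.one_apply, mul_one, Pi.neg_apply, exitRate]
  linarith

theorem generator_nonneg (n : ℕ) (x y : M.State n) (hxy : x ≠ y) : 0 ≤ M.generator n x y := by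
  rcases x with _ | ⟨k, i⟩
  · exact le_rfl
  rcases y with _ | ⟨l, j⟩
  · simp only [generator]
    split_ifs
    · exact M.exitRate_nonneg k i
    · exact le_rfl
  · simp only [generator]
    split_ifs with h1 h2
    · obtain rfl : l = k := Fin.ext h1
      exact M.A_nonneg _ _ _ fun h => hxy (by rw [h]; rfl)
    · exact M.D_nonneg _ _ _
    · exact le_rfl

theorem generator_eq_zero_of_level_lt {n : ℕ} {x y : M.State n} (h : M.level y < M.level x) :
    M.generator n x y = 0 := by
  rcases x with _ | ⟨k, i⟩
  · rfl
  rcases y with _ | ⟨l, j⟩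
  · exact absurd h (by simp only [level]; omega)
  · simp only [level] at h
    simp only [generator]
    rw [dif_neg (by omega), dif_neg (by omega)]

theorem generator_mulVec_none (n : ℕ) (f : M.State n → ℝ) : (M.generator n *ᵥ f) none = 0 := by
  simp [Matrix.mulVec, dotProduct, generator]

/-- With `hF` the absorbing state acts as a block `n` on which `F` is constant, so the last block
obeys the same formula: its absorption rates are the row sums of its `D`. -/
theorem generator_mulVec_blockFun {n : ℕ} (F : ∀ k, Fin (M.dim k) → ℝ) (c : ℝ)
    (hF : ∀ i, F n i = c) (k : Fin n) (i : Fin (M.dim k)) :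
    (M.generator n *ᵥ M.blockFun n F c) (some ⟨k, i⟩) =
      (M.A k *ᵥ F k) i + (M.D k *ᵥ F (k + 1)) i := by
  have hk : ∑ j, M.generator n (some ⟨k, i⟩) (some ⟨k, j⟩) * F k j = (M.A k *ᵥ F k) i := by
    simp [generator, Matrix.mulVec, dotProduct]
  rw [Matrix.mulVec, dotProduct, Fintype.sum_option, Fintype.sum_sigma]
  simp only [blockFun]
  by_cases hn : (k : ℕ) + 1 = n
  · rw [Finset.sum_eq_single k, hk]
    · simp only [generator, hn, if_true]
      rw [add_comm]
      congr 1
      rw [Finset.sum_mul]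
      refine Finset.sum_congr rfl fun j _ => ?_
      congr 1
      have : ∀ (m : ℕ) (h : m = n) (j : Fin (M.dim m)), F m j = c := by
        intro m h; subst h; exact hF
      exact (this _ hn j).symm
    · intro l _ hl
      refine Finset.sum_eq_zero fun j _ => ?_
      have h1 : (l : ℕ) ≠ k := fun h => hl (Fin.ext h)
      have h2 : (l : ℕ) ≠ k + 1 := by have := l.2; omega
      simp [generator, h1, h2]
    · simp
  · have hlt : (k : ℕ) + 1 < n := by have := k.2; omega
    rw [Finset.sum_eq_add k ⟨k + 1, hlt⟩, hk]
    · simp only [generator, hn, if_false, zero_mul, zero_add]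
      congr 1
      refine Finset.sum_congr rfl fun j _ => ?_
      simp
    · intro h; have := congrArg Fin.val h; simp at this
    · rintro l - ⟨hl1, hl2⟩
      refine Finset.sum_eq_zero fun j _ => ?_
      have h1 : (l : ℕ) ≠ k := fun h => hl1 (Fin.ext h)
      have h2 : (l : ℕ) ≠ k + 1 := fun h => hl2 (Fin.ext h)
      simp [generator, h1, h2]
    · simp
    · simp

end PhaseTypeRep

/-! ### Hybrid survival probabilities as sub- and supersolutions -/

namespace PhaseTypeRep

variable (M : PhaseTypeRep)

/-- The probability of leaving the block `k` before the barrier `r k`, when it is entered at time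
`t` and the later blocks are replaced by a random walk with step distribution `μ`. -/
noncomputable def hybridSurvival (μ : Measure ℝ) (r : ℕ → ℝ) (n k : ℕ) (t : ℝ) :
    Fin (M.dim k) → ℝ :=
  blockSurvival (M.A k) (M.exitRate k) (walkSurvival μ r (k + 1) (n - (k + 1))) (r k) t

/-- The hybrid survival probabilities in the blocks `k ≥ m`, and the constant `c` in the earlier
blocks, for which the barrier has already passed. -/
noncomputable def stageFun (μ : Measure ℝ) (r : ℕ → ℝ) (n : ℕ) (c : ℝ) (m : ℕ) (t : ℝ) (k : ℕ) :
    Fin (M.dim k) → ℝ :=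
  if k < m then fun _ => c else if k < n then M.hybridSurvival μ r n k t else 1

variable {M} {μ : Measure ℝ} {r : ℕ → ℝ} {n : ℕ}

theorem stageFun_last {c : ℝ} {m : ℕ} (hm : m ≤ n) (t : ℝ) (i : Fin (M.dim n)) :
    M.stageFun μ r n c m t n i = 1 := by
  simp [stageFun, Nat.not_lt.2 hm]

theorem mulVec_const_add_mulVec_const (k : ℕ) (c : ℝ) (i : Fin (M.dim k)) :
    (M.A k *ᵥ fun _ => c) i + (M.D k *ᵥ fun _ => c) i = 0 := by
  have := M.row_sum k i
  simp only [Matrix.mulVec, dotProduct, ← Finset.sum_mul]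
  rw [← add_mul, this, zero_mul]

theorem exitRate_mul_eq (k : ℕ) (c : ℝ) (i : Fin (M.dim k)) :
    M.exitRate k i * c = (M.D k *ᵥ fun _ => c) i := by
  rw [exitRate, Finset.sum_mul]; rfl

theorem D_mulVec_mono (k : ℕ) {v w : Fin (M.dim (k + 1)) → ℝ} (h : ∀ i, v i ≤ w i)
    (i : Fin (M.dim k)) : (M.D k *ᵥ v) i ≤ (M.D k *ᵥ w) i := by
  simp only [Matrix.mulVec, dotProduct]
  exact Finset.sum_le_sum fun j _ => mul_le_mul_of_nonneg_left (h j) (M.D_nonneg k i j)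

/-- The observation times: time `0`, followed by the barriers. -/
def barrierTime {α : Type*} [Zero α] (r : ℕ → α) : ℕ → α
  | 0 => 0
  | m + 1 => r m

/-- At its own barrier the block `m` has hybrid survival `0`, since the integral runs over an empty
interval; so it may join the failed blocks. -/
theorem blockFun_stageFun_barrier (m : ℕ) (x : M.State n) :
    M.blockFun n (M.stageFun μ r n 0 m (r m)) 1 x =
      M.blockFun n (M.stageFun μ r n 0 (m + 1) (r m)) 1 x := by
  rcases x with _ | ⟨k, i⟩
  · rfl
  · simp only [blockFun, stageFun]
    rcases lt_trichotomy (k : ℕ) m with h | h | h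
    · simp [h, Nat.lt_succ_of_lt h]
    · have h0 : M.hybridSurvival μ r n k (r m) = 0 := by
        rw [← h]; exact blockSurvival_self _ _ _ _
      have hm : m < n := h ▸ k.2
      simp [h, h0, hm]
    · simp [Nat.not_lt.2 h.le, Nat.not_lt.2 (Nat.succ_le_of_lt h)]

/-- The indicator erases the failed blocks, so their value `c` is free between barriers: `0` suits
subsolutions, `1` supersolutions. -/
theorem blockFun_stageFun_zero_eq_indicator (c : ℝ) {m : ℕ} (hm : m ≤ n) (t : ℝ) :
    M.blockFun n (M.stageFun μ r n 0 m t) 1 =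
      {x | m ≤ M.level x}.indicator (M.blockFun n (M.stageFun μ r n c m t) 1) := by
  ext x
  rcases x with _ | ⟨k, i⟩
  · rw [Set.indicator_of_mem (by simpa [level] using hm)]
    rfl
  · by_cases h : (k : ℕ) < m
    · rw [Set.indicator_of_notMem (by simpa [level] using h)]
      simp [blockFun, stageFun, h]
    · rw [Set.indicator_of_mem (by simpa [level] using h)]
      simp [blockFun, stageFun, h]

theorem indicator_level_eq_blockFun (t : ℝ) :
    {x : M.State n | n ≤ M.level x}.indicator 1 =
      M.blockFun n (M.stageFun μ r n 0 n t) 1 := by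
  ext x
  rcases x with _ | ⟨k, i⟩
  · simp [level, blockFun]
  · simp [level, blockFun, stageFun]

theorem sum_initial_mul (hn : 0 < n) (f : M.State n → ℝ) :
    ∑ x, M.initial n x * f x = ∑ i, M.α i * f (some ⟨⟨0, hn⟩, i⟩) := by
  rw [Fintype.sum_option, Fintype.sum_sigma, Finset.sum_eq_single ⟨0, hn⟩]
  · simp [initial]
  · intro l _ hl
    refine Finset.sum_eq_zero fun j _ => ?_
    have h1 : (l : ℕ) ≠ 0 := fun h => hl (Fin.ext h)
    simp [initial, h1]
  · simp

variable [NullSingletonClass μ] [IsProbabilityMeasure μ]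

theorem walkSurvival_le_hybridSurvival (hμ : μ (Set.Iio 0) = 0) {k : ℕ}
    (htail : ∀ a, 0 ≤ a → ∀ i, (NormedSpace.exp (a • M.A k) *ᵥ 1) i ≤ 1 - μ.real (Set.Iic a))
    (hk : k < n) {t : ℝ} (ht : t ≤ r k) (i : Fin (M.dim k)) :
    walkSurvival μ r k (n - k) t ≤ M.hybridSurvival μ r n k t i := by
  rw [show n - k = n - (k + 1) + 1 by omega]
  exact walkSurvival_le_blockSurvival (M.A_nonneg k) (M.exitRate_nonneg k) (M.mulVec_one_eq k) hμ
    htail r k _ ht i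

theorem hybridSurvival_le_walkSurvival (hμ : μ (Set.Iio 0) = 0) {k : ℕ}
    (htail : ∀ a, 0 ≤ a → ∀ i, 1 - μ.real (Set.Iic a) ≤ (NormedSpace.exp (a • M.A k) *ᵥ 1) i)
    (hk : k < n) {t : ℝ} (ht : t ≤ r k) (i : Fin (M.dim k)) :
    M.hybridSurvival μ r n k t i ≤ walkSurvival μ r k (n - k) t := by
  rw [show n - k = n - (k + 1) + 1 by omega]
  exact blockSurvival_le_walkSurvival (M.A_nonneg k) (M.exitRate_nonneg k) (M.mulVec_one_eq k) hμ
    htail r k _ ht i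

theorem hasDerivAt_blockFun_stageFun (c : ℝ) (m : ℕ) (s : ℝ) (x : M.State n) :
    HasDerivAt (fun t => M.blockFun n (M.stageFun μ r n c m t) 1 x)
      (M.blockFun n (fun k i => if k < m then 0 else
        -(M.A k *ᵥ M.hybridSurvival μ r n k s) i
          - M.exitRate k i * walkSurvival μ r (k + 1) (n - (k + 1)) s) 0 x) s := by
  rcases x with _ | ⟨k, i⟩
  · exact hasDerivAt_const s (1 : ℝ)
  · by_cases h : (k : ℕ) < m
    · simp only [blockFun, stageFun, h, if_true]
      exact hasDerivAt_const s c
    · simp only [blockFun, stageFun, h, k.2, if_true, if_false]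
      exact hasDerivAt_blockSurvival (M.A k) (M.exitRate k) (continuous_walkSurvival r _ _) _ s i

/-- In a block `k ≥ m` the time derivative cancels `A_k z_k` and leaves `D_k (z_{k+1} - w_{k+1}) ≥
0`. As `r` is monotone, times up to `r m` precede all later barriers, where `hz` applies. -/
theorem blockFun_stageFun_le_exp_mulVec (hr : Monotone r)
    (hz : ∀ k < n, ∀ t ≤ r k, ∀ i, walkSurvival μ r k (n - k) t ≤ M.hybridSurvival μ r n k t i)
    {m : ℕ} (hm : m < n) {a b : ℝ} (hab : a ≤ b) (hb : b ≤ r m) (x : M.State n) :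
    M.blockFun n (M.stageFun μ r n 0 m a) 1 x ≤
      (NormedSpace.exp ((b - a) • M.generator n) *ᵥ M.blockFun n (M.stageFun μ r n 0 m b) 1) x := by
  refine le_exp_smul_mulVec (M.generator_nonneg n) hab
    (fun s _ x => hasDerivAt_blockFun_stageFun 0 m s x) (fun s hs x => ?_) x
  have hw : ∀ k, m ≤ k → k ≤ n → ∀ i,
      walkSurvival μ r k (n - k) s ≤ M.stageFun μ r n 0 m s k i := by
    intro k hmk hkn i
    rw [stageFun, if_neg (by omega)]
    split_ifs with h
    · exact hz k h s (hs.2.trans (hb.trans (hr hmk))) i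
    · exact walkSurvival_le_one r _ _ _
  rcases x with _ | ⟨k, i⟩
  · rw [generator_mulVec_none]; simp [blockFun]
  · rw [generator_mulVec_blockFun _ _ _ (stageFun_last hm.le s)]
    simp only [blockFun]
    -- In a failed block the function is `0`, and the next block contributes a nonnegative amount.
    by_cases hkm : (k : ℕ) < m
    · rw [if_pos hkm, add_zero]
      have h0 : M.stageFun μ r n 0 m s k = fun _ => 0 := by rw [stageFun, if_pos hkm]
      have h1 := D_mulVec_mono k (v := fun _ => 0) (w := M.stageFun μ r n 0 m s (k + 1))
        (fun j => by
          by_cases hk' : (k : ℕ) + 1 < m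
          · rw [stageFun, if_pos hk']
          · exact (walkSurvival_nonneg r _ _ _).trans (hw _ (by omega) k.2 j)) i
      rw [h0]
      linarith [mulVec_const_add_mulVec_const k 0 i]
    · have h0 : M.stageFun μ r n 0 m s k = M.hybridSurvival μ r n k s := by
        rw [stageFun, if_neg hkm, if_pos k.2]
      have h1 := D_mulVec_mono k (hw (k + 1) (by omega) k.2) i
      rw [if_neg hkm, h0, exitRate_mul_eq]
      linarith

theorem exp_mulVec_blockFun_stageFun_le (hr : Monotone r)
    (hz : ∀ k < n, ∀ t ≤ r k, ∀ i, M.hybridSurvival μ r n k t i ≤ walkSurvival μ r k (n - k) t)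
    {m : ℕ} (hm : m < n) {a b : ℝ} (hab : a ≤ b) (hb : b ≤ r m) (x : M.State n) :
    (NormedSpace.exp ((b - a) • M.generator n) *ᵥ M.blockFun n (M.stageFun μ r n 1 m b) 1) x ≤
      M.blockFun n (M.stageFun μ r n 1 m a) 1 x := by
  refine exp_smul_mulVec_le (M.generator_nonneg n) hab
    (fun s _ x => hasDerivAt_blockFun_stageFun 1 m s x) (fun s hs x => ?_) x
  have hw : ∀ k, m ≤ k → k ≤ n → ∀ i,
      M.stageFun μ r n 1 m s k i ≤ walkSurvival μ r k (n - k) s := by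
    intro k hmk hkn i
    rw [stageFun, if_neg (by omega)]
    split_ifs with h
    · exact hz k h s (hs.2.trans (hb.trans (hr hmk))) i
    · obtain rfl : k = n := by omega
      simp [walkSurvival]
  rcases x with _ | ⟨k, i⟩
  · rw [generator_mulVec_none]; simp [blockFun]
  · rw [generator_mulVec_blockFun _ _ _ (stageFun_last hm.le s)]
    simp only [blockFun]
    -- In a failed block the function is `1`, which bounds the value in the next block.
    by_cases hkm : (k : ℕ) < m
    · rw [if_pos hkm, add_zero]
      have h0 : M.stageFun μ r n 1 m s k = fun _ => 1 := by rw [stageFun, if_pos hkm]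
      have h1 := D_mulVec_mono k (v := M.stageFun μ r n 1 m s (k + 1)) (w := fun _ => 1)
        (fun j => by
          by_cases hk' : (k : ℕ) + 1 < m
          · rw [stageFun, if_pos hk']
          · exact (hw _ (by omega) k.2 j).trans (walkSurvival_le_one r _ _ _)) i
      rw [h0]
      linarith [mulVec_const_add_mulVec_const k 1 i]
    · have h0 : M.stageFun μ r n 1 m s k = M.hybridSurvival μ r n k s := by
        rw [stageFun, if_neg hkm, if_pos k.2]
      have h1 := D_mulVec_mono k (hw (k + 1) (by omega) k.2) i
      rw [if_neg hkm, h0, exitRate_mul_eq]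
      linarith

/-- Descending induction on `m`: the subsolution property covers the time between consecutive
barriers, and `blockFun_stageFun_barrier` crosses a barrier. -/
theorem blockFun_le_backwardProb (hr : Monotone r) (hr0 : 0 ≤ r 0)
    (hz : ∀ k < n, ∀ t ≤ r k, ∀ i, walkSurvival μ r k (n - k) t ≤ M.hybridSurvival μ r n k t i)
    (q : ℕ) : ∀ (m : ℕ) (_ : m + q = n) (x : M.State n),
    M.blockFun n (M.stageFun μ r n 0 m (barrierTime r m)) 1 x ≤
      {x : M.State n | m ≤ M.level x}.indicator (backwardProb (M.generator n) (barrierTime r)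
        (fun m => {x | m ≤ M.level x}) m q) x := by
  induction q with
  | zero =>
    rintro m rfl x
    exact (congrFun (indicator_level_eq_blockFun _) x).ge
  | succ q ih =>
    intro m hm x
    rw [blockFun_stageFun_zero_eq_indicator 0 (by omega)]
    refine Set.indicator_le_indicator ?_
    have hle : barrierTime r m ≤ r m := by
      rcases m with _ | m
      · exact hr0
      · exact hr (Nat.le_succ m)
    refine (blockFun_stageFun_le_exp_mulVec hr hz (by omega : m < n) hle le_rfl x).trans ?_
    exact exp_smul_mulVec_mono (M.generator_nonneg n) (sub_nonneg.2 hle)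
      (fun y => (blockFun_stageFun_barrier m y).trans_le (ih (m + 1) (by omega) y)) x

theorem backwardProb_le_blockFun (hr : Monotone r) (hr0 : 0 ≤ r 0)
    (hz : ∀ k < n, ∀ t ≤ r k, ∀ i, M.hybridSurvival μ r n k t i ≤ walkSurvival μ r k (n - k) t)
    (q : ℕ) : ∀ (m : ℕ) (_ : m + q = n) (x : M.State n),
    {x : M.State n | m ≤ M.level x}.indicator (backwardProb (M.generator n) (barrierTime r)
        (fun m => {x | m ≤ M.level x}) m q) x ≤
      M.blockFun n (M.stageFun μ r n 0 m (barrierTime r m)) 1 x := by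
  induction q with
  | zero =>
    rintro m rfl x
    exact (congrFun (indicator_level_eq_blockFun _) x).le
  | succ q ih =>
    intro m hm x
    rw [blockFun_stageFun_zero_eq_indicator 1 (by omega)]
    refine Set.indicator_le_indicator ?_
    have hle : barrierTime r m ≤ r m := by
      rcases m with _ | m
      · exact hr0
      · exact hr (Nat.le_succ m)
    refine le_trans ?_ (exp_mulVec_blockFun_stageFun_le hr hz (by omega : m < n) hle le_rfl x)
    refine exp_smul_mulVec_mono (M.generator_nonneg n) (sub_nonneg.2 hle) (fun y => ?_) x
    refine (ih (m + 1) (by omega) y).trans ?_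
    refine (blockFun_stageFun_barrier m y).symm.trans_le ?_
    -- Raising the value on the failed blocks from `0` to `1` only weakens an upper bound.
    rcases y with _ | ⟨k, i⟩
    · exact le_rfl
    · by_cases h : (k : ℕ) < m
      · simp [blockFun, stageFun, h]
      · simp [blockFun, stageFun, h]

section JumpProcess

variable {Ω : Type*} [MeasurableSpace Ω] {P : Measure Ω} [IsProbabilityMeasure P]
  {φ : ℝ≥0 → Ω → M.State n} {ρ : ℕ → ℝ≥0}

theorem measureReal_level_eq_sum (hn : 0 < n)
    (h : IsMarkovJumpProcess (M.generator n) (M.initial n) φ P) (hρ : Monotone ρ) :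
    P.real {ω | ∀ m < n, m + 1 ≤ M.level (φ (ρ m) ω)} =
      ∑ i, M.α i * {x : M.State n | 0 ≤ M.level x}.indicator (backwardProb (M.generator n)
        (barrierTime fun m => (ρ m : ℝ)) (fun m => {x | m ≤ M.level x}) 0 n)
        (some ⟨⟨0, hn⟩, i⟩) := by
  have hmono : Monotone (barrierTime ρ) := monotone_nat_of_le_succ fun m => by
    rcases m with _ | m
    · exact bot_le
    · exact hρ (Nat.le_succ m)
  have e := measureReal_forall_mem_eq_backwardProb h hmono rfl (fun m => {x | m ≤ M.level x}) n
  have e1 : (fun i => ((barrierTime ρ i : ℝ≥0) : ℝ)) = barrierTime fun m => (ρ m : ℝ) := by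
    funext i; rcases i with _ | i <;> rfl
  have e2 : {ω | ∀ m < n, m + 1 ≤ M.level (φ (ρ m) ω)} =
      {ω | ∀ i, 0 < i → i ≤ n → φ (barrierTime ρ i) ω ∈ {x | i ≤ M.level x}} := by
    ext ω
    constructor
    · rintro hω (_ | i) hi hin
      · exact absurd hi (lt_irrefl _)
      · exact hω i hin
    · exact fun hω m hm => hω (m + 1) (Nat.succ_pos m) hm
  rw [e2, e, e1, sum_initial_mul hn]
  refine Finset.sum_congr rfl fun i _ => ?_
  rw [Set.indicator_of_mem (s := {x : M.State n | 0 ≤ M.level x}) (Nat.zero_le _)]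

/-- If the sojourn times in the blocks are stochastically dominated by `μ`, then the exit times of
the blocks meet the barriers at least as often as the random walk with step distribution `μ`. -/
theorem walkSurvival_le_measureReal_level (hn : 0 < n)
    (h : IsMarkovJumpProcess (M.generator n) (M.initial n) φ P) (hρ : Monotone ρ)
    (hμ : μ (Set.Iio 0) = 0) (htail : ∀ k a, 0 ≤ a → ∀ i,
      (NormedSpace.exp (a • M.A k) *ᵥ 1) i ≤ 1 - μ.real (Set.Iic a)) :
    walkSurvival μ (fun m => ρ m) 0 n 0 ≤
      P.real {ω | ∀ m < n, m + 1 ≤ M.level (φ (ρ m) ω)} := by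
  rw [measureReal_level_eq_sum hn h hρ, ← one_mul (walkSurvival _ _ _ _ _), ← M.α_sum,
    Finset.sum_mul]
  refine Finset.sum_le_sum fun i _ => mul_le_mul_of_nonneg_left ?_ (M.α_nonneg i)
  have hz : ∀ k < n, ∀ t ≤ (ρ k : ℝ), ∀ i, walkSurvival μ (fun m => (ρ m : ℝ)) k (n - k) t ≤
      M.hybridSurvival μ (fun m => ρ m) n k t i := fun k hk t ht i =>
    walkSurvival_le_hybridSurvival hμ (htail k) hk ht i
  refine le_trans ?_ (blockFun_le_backwardProb (r := fun m => (ρ m : ℝ)) (fun a b hab => hρ hab)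
    (ρ 0).2 hz n 0 (zero_add n) _)
  -- At time `0` the bound is `z_0`; one last use of `hz` trades the first block for a step of the
  -- walk.
  simpa [blockFun, stageFun, hn, barrierTime] using hz 0 hn 0 (ρ 0).2 i

theorem measureReal_level_le_walkSurvival (hn : 0 < n)
    (h : IsMarkovJumpProcess (M.generator n) (M.initial n) φ P) (hρ : Monotone ρ)
    (hμ : μ (Set.Iio 0) = 0) (htail : ∀ k a, 0 ≤ a → ∀ i,
      1 - μ.real (Set.Iic a) ≤ (NormedSpace.exp (a • M.A k) *ᵥ 1) i) :
    P.real {ω | ∀ m < n, m + 1 ≤ M.level (φ (ρ m) ω)} ≤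
      walkSurvival μ (fun m => ρ m) 0 n 0 := by
  rw [measureReal_level_eq_sum hn h hρ, ← one_mul (walkSurvival _ _ _ _ _), ← M.α_sum,
    Finset.sum_mul]
  refine Finset.sum_le_sum fun i _ => mul_le_mul_of_nonneg_left ?_ (M.α_nonneg i)
  have hz : ∀ k < n, ∀ t ≤ (ρ k : ℝ), ∀ i, M.hybridSurvival μ (fun m => ρ m) n k t i ≤
      walkSurvival μ (fun m => (ρ m : ℝ)) k (n - k) t := fun k hk t ht i =>
    hybridSurvival_le_walkSurvival hμ (htail k) hk ht i
  refine (backwardProb_le_blockFun (r := fun m => (ρ m : ℝ)) (fun a b hab => hρ hab)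
    (ρ 0).2 hz n 0 (zero_add n) _).trans ?_
  simpa [blockFun, stageFun, hn, barrierTime] using hz 0 hn 0 (ρ 0).2 i

end JumpProcess

end PhaseTypeRep

/-! ### From occupation times to levels of the path -/

theorem exists_mem_dense_of_eventually_nhdsGT {D : Set ℝ≥0} (hD : Dense D) {s : ℝ≥0}
    {p : ℝ≥0 → Prop} (h : ∀ᶠ x in 𝓝[>] s, p x) : ∃ x ∈ D, p x := by
  obtain ⟨u, hu, hsub⟩ := mem_nhdsGT_iff_exists_Ioo_subset.1 h
  obtain ⟨x, hxD, hx⟩ := hD.exists_between hu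
  exact ⟨x, hxD, hsub hx⟩

theorem sum_filter_fin_le_eq_sum_range {n m : ℕ} (hm : m < n) (f : ℕ → ℝ) :
    ∑ k ∈ Finset.univ.filter (fun k : Fin n => (k : ℕ) ≤ m), f k =
      ∑ k ∈ Finset.range (m + 1), f k := by
  rw [Finset.sum_filter, Fin.sum_univ_eq_sum_range (fun k => if k ≤ m then f k else 0) n,
    ← Finset.sum_filter]
  congr 1
  ext k
  simp only [Finset.mem_filter, Finset.mem_range]
  omega

namespace PhaseTypeRep

variable {M : PhaseTypeRep} {n : ℕ}

theorem exp_generator_eq_zero_of_level_lt (t : ℝ) {x y : M.State n}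
    (h : M.level y < M.level x) : NormedSpace.exp (t • M.generator n) x y = 0 := by
  have hb : (t • M.generator n).BlockTriangular (M.level (n := n)) := fun x y h => by
    rw [Matrix.smul_apply, generator_eq_zero_of_level_lt M h, smul_zero]
  exact hb.exp h

section Deterministic

variable {φ : ℝ≥0 → M.State n}

theorem setOf_mem_block_eq (k : Fin n) :
    {s : ℝ | 0 ≤ s ∧ ∃ i : Fin (M.dim k), φ s.toNNReal = some ⟨k, i⟩} =
      {s : ℝ | 0 ≤ s ∧ M.level (φ s.toNNReal) = k} := by
  ext s
  refine and_congr_right fun _ => ⟨fun ⟨i, hi⟩ => by rw [hi]; rfl, fun h => ?_⟩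
  rcases hφ : φ s.toNNReal with _ | ⟨l, i⟩
  · rw [hφ] at h
    exact absurd h (Nat.ne_of_gt k.2)
  · rw [hφ] at h
    obtain rfl : l = k := Fin.ext h
    exact ⟨i, rfl⟩

theorem measurableSet_block (hmono : Monotone fun t => M.level (φ t)) (k : Fin n) :
    MeasurableSet {s : ℝ | 0 ≤ s ∧ ∃ i : Fin (M.dim k), φ s.toNNReal = some ⟨k, i⟩} := by
  rw [setOf_mem_block_eq]
  refine Set.OrdConnected.measurableSet ⟨fun x hx y hy z hz => ⟨hx.1.trans hz.1, ?_⟩⟩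
  have h1 := hmono (Real.toNNReal_le_toNNReal hz.1)
  have h2 := hmono (Real.toNNReal_le_toNNReal hz.2)
  simp only at h1 h2
  exact le_antisymm (h2.trans_eq hy.2) (hx.2.symm.trans_le h1)

theorem sum_timeIn_eq (hmono : Monotone fun t => M.level (φ t)) {m : ℕ} (hm : m < n) :
    ∑ k ∈ Finset.univ.filter (fun k : Fin n => (k : ℕ) ≤ m), M.timeIn φ k =
      volume {s : ℝ | 0 ≤ s ∧ M.level (φ s.toNNReal) ≤ m} := by
  have e : {s : ℝ | 0 ≤ s ∧ M.level (φ s.toNNReal) ≤ m} =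
      ⋃ k ∈ (Finset.univ.filter fun k : Fin n => (k : ℕ) ≤ m),
        {s : ℝ | 0 ≤ s ∧ ∃ i : Fin (M.dim k), φ s.toNNReal = some ⟨k, i⟩} := by
    ext s
    simp only [setOf_mem_block_eq, Set.mem_ofPred_eq, Set.mem_iUnion, Finset.mem_filter,
      Finset.mem_univ, true_and, exists_prop]
    constructor
    · rintro ⟨h0, h⟩
      exact ⟨⟨_, h.trans_lt hm⟩, h, h0, rfl⟩
    · rintro ⟨k, hk, h0, h⟩
      exact ⟨h0, h.trans_le hk⟩
  rw [e, measure_biUnion_finset]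
  · rfl
  · intro k _ l _ hkl
    refine Set.disjoint_left.2 fun s hs hs' => hkl ?_
    obtain ⟨-, i, hi⟩ := hs
    obtain ⟨-, j, hj⟩ := hs'
    have := hi.symm.trans hj
    simp only [Option.some.injEq, Sigma.mk.injEq] at this
    exact this.1
  · exact fun k _ => measurableSet_block hmono k

/-- The first `m + 1` blocks are left by time `t` if and only if the total time spent in them is
at most `t`. -/
theorem sum_timeIn_le_iff (hmono : Monotone fun t => M.level (φ t))
    (hrc : ∀ t : ℝ≥0, ∀ᶠ s in 𝓝[≥] t, φ s = φ t) {T : ℝ≥0} (hT : ∀ m < n, m + 1 ≤ M.level (φ T))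
    {m : ℕ} (hm : m < n) (t : ℝ≥0) :
    ∑ k ∈ Finset.univ.filter (fun k : Fin n => (k : ℕ) ≤ m), (M.timeIn φ k).toReal ≤ t ↔
      m + 1 ≤ M.level (φ t) := by
  set A : Set ℝ := {s : ℝ | 0 ≤ s ∧ M.level (φ s.toNNReal) ≤ m} with hA
  have hAsub : ∀ t : ℝ≥0, m + 1 ≤ M.level (φ t) → A ⊆ Set.Icc 0 (t : ℝ) := by
    intro t ht s hs
    refine ⟨hs.1, ?_⟩
    by_contra! hcon
    have h1 := hmono (show t ≤ s.toNNReal from NNReal.le_toNNReal_of_coe_le hcon.le)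
    have h2 := hs.2
    simp only at h1
    omega
  -- The time `T` keeps the occupation times finite, so `toReal` neither turns `∞` into `0` nor
  -- breaks additivity.
  have hAfin : volume A ≠ ∞ :=
    ((measure_mono (hAsub T (hT m hm))).trans_lt measure_Icc_lt_top).ne
  have hsum := sum_timeIn_eq hmono hm
  have hfin : ∀ k ∈ Finset.univ.filter (fun k : Fin n => (k : ℕ) ≤ m), M.timeIn φ k ≠ ∞ := by
    intro k hk h
    rw [← hA] at hsum
    exact hAfin (hsum ▸ ENNReal.sum_eq_top.2 ⟨k, hk, h⟩)
  rw [← ENNReal.toReal_sum hfin, hsum, ← hA]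
  constructor
  · intro h
    by_contra! hcon
    -- By right-continuity the level stays at most `m` beyond `t`, up to some `u > t`, which makes
    -- the total time at least `u`.
    obtain ⟨u, hu, hsub⟩ := mem_nhdsGE_iff_exists_Ico_subset.1 (hrc t)
    have hI : Set.Ico (0 : ℝ) u ⊆ A := by
      intro s hs
      refine ⟨hs.1, ?_⟩
      have hsu : s.toNNReal < u := (Real.toNNReal_lt_iff_lt_coe hs.1).2 hs.2
      rcases le_total s.toNNReal t with hst | hst
      · have := hmono hst
        simp only at this
        omega
      · have : φ s.toNNReal = φ t := hsub ⟨hst, hsu⟩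
        rw [this]
        omega
    have h1 := ENNReal.toReal_mono hAfin (measure_mono hI)
    rw [Real.volume_Ico, sub_zero, ENNReal.toReal_ofReal u.coe_nonneg] at h1
    have h2 : (t : ℝ) < u := hu
    linarith
  · intro h
    have h1 := ENNReal.toReal_mono measure_Icc_lt_top.ne (measure_mono (μ := volume) (hAsub t h))
    rwa [Real.volume_Icc, sub_zero, ENNReal.toReal_ofReal t.coe_nonneg] at h1

end Deterministic

variable {Ω : Type*} [MeasurableSpace Ω] {P : Measure Ω} {φ : ℝ≥0 → Ω → M.State n}

theorem measurableSet_level (h : IsMarkovJumpProcess (M.generator n) (M.initial n) φ P)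
    (ρ : ℕ → ℝ≥0) : MeasurableSet {ω | ∀ m < n, m + 1 ≤ M.level (φ (ρ m) ω)} := by
  have : {ω | ∀ m < n, m + 1 ≤ M.level (φ (ρ m) ω)} =
      ⋂ m, ⋂ (_ : m < n), ⋃ x ∈ {x : M.State n | m + 1 ≤ M.level x}, {ω | φ (ρ m) ω = x} := by
    ext ω; simp
  rw [this]
  exact MeasurableSet.iInter fun m => MeasurableSet.iInter fun _ =>
    MeasurableSet.biUnion (Set.to_countable _) fun x _ => h.measurableSet_eq _ _

variable [IsProbabilityMeasure P]

theorem measure_level_lt_eq_zero (h : IsMarkovJumpProcess (M.generator n) (M.initial n) φ P)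
    {s t : ℝ≥0} (hst : s ≤ t) : P {ω | M.level (φ t ω) < M.level (φ s ω)} = 0 := by
  have hsub : {ω | M.level (φ t ω) < M.level (φ s ω)} ⊆
      ⋃ x0 : M.State n, ⋃ x1 : M.State n, ⋃ x2 : M.State n, ⋃ (_ : M.level x2 < M.level x1),
        {ω | φ 0 ω = x0 ∧ φ s ω = x1 ∧ φ t ω = x2} := by
    intro ω hω
    simp only [Set.mem_iUnion]
    exact ⟨_, _, _, hω, rfl, rfl, rfl⟩
  refine measure_mono_null hsub ?_
  simp only [measure_iUnion_null_iff]
  intro x0 x1 x2 hx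
  -- The time `0` is included because `finite_dim` requires the observation times to start there.
  set τ : ℕ → ℝ≥0 := fun j => if j = 0 then 0 else if j = 1 then s else t with hτ
  set x : ℕ → M.State n := fun j => if j = 0 then x0 else if j = 1 then x1 else x2 with hxd
  have hmono : Monotone τ := monotone_nat_of_le_succ fun j => by
    rcases j with _ | _ | j <;> simp [hτ, hst]
  have hf := h.finite_dim 2 τ x hmono (by simp [hτ])
  have hz : NormedSpace.exp (((τ (1 + 1) : ℝ) - (τ 1 : ℝ)) • M.generator n) (x 1) (x (1 + 1)) = 0 :=
    exp_generator_eq_zero_of_level_lt _ (by simpa [hxd] using hx)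
  rw [Finset.prod_range_succ, hz, mul_zero, mul_zero, measureReal_eq_zero_iff] at hf
  refine measure_mono_null ?_ hf
  intro ω hω j hj
  obtain ⟨h0, h1, h2⟩ := hω
  interval_cases j
  · simpa [hτ, hxd] using h0
  · simpa [hτ, hxd] using h1
  · simpa [hτ, hxd] using h2

/-- Each pair of times contributes a null set, by block triangularity of the semigroup. Countably
many pairs suffice, and right-continuity extends the order to all times. -/
theorem ae_monotone_level (h : IsMarkovJumpProcess (M.generator n) (M.initial n) φ P) :
    ∀ᵐ ω ∂P, Monotone fun t => M.level (φ t ω) := by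
  obtain ⟨D, hDc, hD⟩ := TopologicalSpace.exists_countable_dense ℝ≥0
  have h1 : ∀ᵐ ω ∂P, ∀ s ∈ D, ∀ t ∈ D, s ≤ t → M.level (φ s ω) ≤ M.level (φ t ω) := by
    rw [ae_ball_iff hDc]
    intro s _
    rw [ae_ball_iff hDc]
    intro t _
    by_cases hst : s ≤ t
    · have := measure_level_lt_eq_zero h hst
      rw [ae_iff]
      simpa [hst] using this
    · exact ae_of_all _ fun ω h => absurd h hst
  filter_upwards [h1, h.right_continuous] with ω hω hrc
  refine monotone_iff_forall_lt.2 fun s t hst => ?_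
  have hs : ∀ᶠ x in 𝓝[>] s, φ x ω = φ s ω ∧ x < t :=
    ((hrc s).filter_mono (nhdsWithin_mono _ Set.Ioi_subset_Ici_self)).and
      (mem_of_superset (Ioo_mem_nhdsGT hst) fun x hx => hx.2)
  have ht : ∀ᶠ x in 𝓝[>] t, φ x ω = φ t ω ∧ t < x :=
    ((hrc t).filter_mono (nhdsWithin_mono _ Set.Ioi_subset_Ici_self)).and self_mem_nhdsWithin
  obtain ⟨s', hs'D, hs', hs't⟩ := exists_mem_dense_of_eventually_nhdsGT hD hs
  obtain ⟨t', ht'D, ht', htt'⟩ := exists_mem_dense_of_eventually_nhdsGT hD ht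
  rw [← hs', ← ht']
  exact hω s' hs'D t' ht'D (hs't.trans htt').le

theorem ae_exists_level_of_tendsto (h : IsMarkovJumpProcess (M.generator n) (M.initial n) φ P)
    (hT : Tendsto (fun N : ℕ => P.real {ω | ∀ m < n, m + 1 ≤ M.level (φ (N : ℝ≥0) ω)}) atTop
      (𝓝 1)) : ∀ᵐ ω ∂P, ∃ T : ℝ≥0, ∀ m < n, m + 1 ≤ M.level (φ T ω) := by
  set A : Set Ω := ⋃ N : ℕ, {ω | ∀ m < n, m + 1 ≤ M.level (φ (N : ℝ≥0) ω)} with hA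
  have hAm : MeasurableSet A := MeasurableSet.iUnion fun N => measurableSet_level h fun _ => N
  have h1 : 1 ≤ P.real A := le_of_tendsto' hT fun N =>
    measureReal_mono (Set.subset_iUnion (fun N : ℕ =>
      {ω | ∀ m < n, m + 1 ≤ M.level (φ (N : ℝ≥0) ω)}) N)
  have h2 : P Aᶜ = 0 := by
    rw [← measureReal_eq_zero_iff, probReal_compl_eq_one_sub hAm]
    linarith [measureReal_le_one (μ := P) (s := A)]
  filter_upwards [compl_mem_ae_iff.2 h2] with ω hω
  rw [compl_compl] at hω
  obtain ⟨N, hN⟩ := Set.mem_iUnion.1 hω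
  exact ⟨N, hN⟩

theorem measure_sum_timeIn_eq (h : IsMarkovJumpProcess (M.generator n) (M.initial n) φ P)
    (hT : Tendsto (fun N : ℕ => P.real {ω | ∀ m < n, m + 1 ≤ M.level (φ (N : ℝ≥0) ω)}) atTop
      (𝓝 1)) (ρ : ℕ → ℝ≥0) :
    P {ω | ∀ m < n, ∑ k ∈ Finset.univ.filter (fun k : Fin n => (k : ℕ) ≤ m),
        (M.timeIn (fun s => φ s ω) k).toReal ≤ ρ m} =
      P {ω | ∀ m < n, m + 1 ≤ M.level (φ (ρ m) ω)} := by
  refine measure_congr ?_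
  filter_upwards [ae_monotone_level h, h.right_continuous, ae_exists_level_of_tendsto h hT]
    with ω h1 h2 ⟨T, h3⟩
  exact propext (forall₂_congr fun m hm => sum_timeIn_le_iff h1 h2 h3 hm (ρ m))

end PhaseTypeRep

/-! ### Reduction of ruin to partial sums below monotone barriers -/

section Ruin

/-- The smallest barrier `b i` that applies to the claim number `m`. -/
noncomputable def claimBarrier {ι : Type*} [Fintype ι] (b : ι → ℝ≥0) (κ : ι → ℕ) (m : ℕ) : ℝ≥0 :=
  if h : (Finset.univ.filter fun i => m < κ i).Nonempty then
    (Finset.univ.filter fun i => m < κ i).inf' h b else Finset.univ.sup b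

/-- Fewer barriers apply to a later claim, so their minimum rises; the default, the largest barrier,
keeps this true when none applies. -/
theorem monotone_claimBarrier {ι : Type*} [Fintype ι] (b : ι → ℝ≥0) (κ : ι → ℕ) :
    Monotone (claimBarrier b κ) := by
  intro m m' hmm
  have hsub : (Finset.univ.filter fun i => m' < κ i) ⊆ Finset.univ.filter fun i => m < κ i :=
    fun i hi => by
      simp only [Finset.mem_filter, Finset.mem_univ, true_and] at hi ⊢
      omega
  unfold claimBarrier
  by_cases h' : (Finset.univ.filter fun i => m' < κ i).Nonempty
  · rw [dif_pos h', dif_pos (h'.mono hsub)]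
    exact Finset.inf'_mono b hsub h'
  · rw [dif_neg h']
    split_ifs with h
    · obtain ⟨i, hi⟩ := h
      exact (Finset.inf'_le b hi).trans (Finset.le_sup (Finset.mem_univ i))
    · exact le_rfl

/-- For nonnegative claims, a bound on a longer partial sum also bounds all shorter ones. -/
theorem forall_sum_le_iff_claimBarrier {ι : Type*} [Fintype ι] (b : ι → ℝ≥0) (κ : ι → ℕ)
    {x : ℕ → ℝ} (hx : ∀ k, 0 ≤ x k) :
    (∀ i, ∑ k ∈ Finset.range (κ i), x k ≤ b i) ↔
      ∀ m < Finset.univ.sup κ, ∑ k ∈ Finset.range (m + 1), x k ≤ claimBarrier b κ m := by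
  constructor
  · intro h m hm
    obtain ⟨j, -, hj⟩ := (Finset.lt_sup_iff).1 hm
    have hne : (Finset.univ.filter fun i => m < κ i).Nonempty := ⟨j, by simpa using hj⟩
    obtain ⟨i, hi, hmin⟩ := Finset.exists_mem_eq_inf' hne b
    rw [claimBarrier, dif_pos hne, hmin]
    refine le_trans ?_ (h i)
    refine Finset.sum_le_sum_of_subset_of_nonneg (Finset.range_mono ?_) fun k _ _ => hx k
    simpa using hi
  · intro h i
    rcases hk : κ i with _ | m
    · simp
    · have hi : m < κ i := by omega
      refine (h m (Finset.lt_sup_iff.2 ⟨i, Finset.mem_univ i, hi⟩)).trans ?_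
      have hmem : i ∈ Finset.univ.filter fun i => m < κ i := by simpa using hi
      rw [claimBarrier, dif_pos ⟨i, hmem⟩]
      exact_mod_cast Finset.inf'_le b hmem

theorem mem_ultimateRuin_iff {Ω : Type*} {u c : ℝ} {N : ℝ≥0 → Ω → ℕ} {X : ℕ → Ω → ℝ} {ω : Ω} :
    ω ∈ ultimateRuin (reserve u c N X) ↔
      ∃ t : ℝ≥0, u + c * t < ∑ k ∈ Finset.range (N t ω), X k ω := by
  simp only [ultimateRuin, Set.mem_ofPred_eq, iInf_lt_iff]
  refine exists_congr fun t => ?_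
  rw [← EReal.coe_zero, EReal.coe_lt_coe_iff, reserve, sub_neg]

variable {Ω : Type*} [MeasurableSpace Ω] {P : Measure Ω}

theorem nullMeasurableSet_forall_sum_le {ι : Type*} [Countable ι] {X : ℕ → Ω → ℝ}
    (hX : ∀ k, AEMeasurable (X k) P) (b : ι → ℝ≥0) (κ : ι → ℕ) :
    NullMeasurableSet {ω | ∀ i, ∑ k ∈ Finset.range (κ i), X k ω ≤ b i} P := by
  have : {ω | ∀ i, ∑ k ∈ Finset.range (κ i), X k ω ≤ b i} =
      ⋂ i, {ω | ∑ k ∈ Finset.range (κ i), X k ω ≤ b i} := by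
    ext; simp
  rw [this]
  refine NullMeasurableSet.iInter fun i => nullMeasurableSet_le ?_ aemeasurable_const
  exact Finset.aemeasurable_fun_sum _ fun k _ => hX k

theorem measure_exists_lt_sum_le [IsProbabilityMeasure P] {ι : Type*} [Fintype ι]
    {X X' : ℕ → Ω → ℝ}
    (hX : ∀ k, AEMeasurable (X k) P) (hX' : ∀ k, AEMeasurable (X' k) P)
    (hX0 : ∀ᵐ ω ∂P, ∀ k, 0 ≤ X k ω) (hX'0 : ∀ᵐ ω ∂P, ∀ k, 0 ≤ X' k ω)
    (h : ∀ (n : ℕ) (ρ : ℕ → ℝ≥0), Monotone ρ →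
      P {ω | ∀ m < n, ∑ k ∈ Finset.range (m + 1), X' k ω ≤ ρ m} ≤
        P {ω | ∀ m < n, ∑ k ∈ Finset.range (m + 1), X k ω ≤ ρ m})
    (b : ι → ℝ≥0) (κ : ι → ℕ) :
    P {ω | ∀ i, ∑ k ∈ Finset.range (κ i), X k ω ≤ b i}ᶜ ≤
      P {ω | ∀ i, ∑ k ∈ Finset.range (κ i), X' k ω ≤ b i}ᶜ := by
  have key : ∀ {Z : ℕ → Ω → ℝ}, (∀ᵐ ω ∂P, ∀ k, 0 ≤ Z k ω) →
      P {ω | ∀ i, ∑ k ∈ Finset.range (κ i), Z k ω ≤ b i} =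
        P {ω | ∀ m < Finset.univ.sup κ,
          ∑ k ∈ Finset.range (m + 1), Z k ω ≤ claimBarrier b κ m} := by
    intro Z hZ
    refine measure_congr ?_
    filter_upwards [hZ] with ω hω
    exact propext (forall_sum_le_iff_claimBarrier b κ hω)
  rw [prob_compl_eq_one_sub₀ (nullMeasurableSet_forall_sum_le hX b κ),
    prob_compl_eq_one_sub₀ (nullMeasurableSet_forall_sum_le hX' b κ), key hX0, key hX'0]
  exact tsub_le_tsub_left (h _ _ (monotone_claimBarrier b κ)) _

theorem measure_inter_counts_eq {ι : Type*} [Fintype ι] {N : ℝ≥0 → Ω → ℕ} {X : ℕ → Ω → ℝ}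
    (hXN : ∀ n : ℕ, 1 ≤ n →
      IndepFun (fun ω (k : Fin n) => X k ω) (fun ω (t : ℝ≥0) => N t ω) P)
    (q : ι → ℝ≥0) (b : ι → ℝ≥0) (κ : ι → ℕ) :
    P ({ω | ∀ i, ∑ k ∈ Finset.range (κ i), X k ω ≤ b i}ᶜ ∩ {ω | ∀ i, N (q i) ω = κ i}) =
      P {ω | ∀ i, ∑ k ∈ Finset.range (κ i), X k ω ≤ b i}ᶜ * P {ω | ∀ i, N (q i) ω = κ i} := by
  -- All claims involved have index below `sup κ`; the `+ 1` ensures `1 ≤ n`.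
  set n := Finset.univ.sup κ + 1 with hn
  set C : Set (Fin n → ℝ) := {y | ∀ i, ∑ k ∈ Finset.range (κ i),
    (if h : k < n then y ⟨k, h⟩ else 0) ≤ b i} with hC
  have hCm : MeasurableSet C := by
    have : C = ⋂ i, {y | ∑ k ∈ Finset.range (κ i),
        (if h : k < n then y ⟨k, h⟩ else 0) ≤ (b i : ℝ)} := by
      ext; simp [hC]
    rw [this]
    refine MeasurableSet.iInter fun i => measurableSet_le ?_ measurable_const
    refine Finset.measurable_fun_sum _ fun k _ => ?_
    by_cases h : k < n
    · simp only [h, dif_pos]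
      fun_prop
    · simp [h]
  set K : Set (ℝ≥0 → ℕ) := {f | ∀ i, f (q i) = κ i} with hK
  have hKm : MeasurableSet K := by
    have : K = ⋂ i, (fun f : ℝ≥0 → ℕ => f (q i)) ⁻¹' {κ i} := by
      ext; simp [hK]
    rw [this]
    exact MeasurableSet.iInter fun i => measurable_pi_apply _ (measurableSet_singleton _)
  have e : {ω | ∀ i, ∑ k ∈ Finset.range (κ i), X k ω ≤ b i}ᶜ =
      (fun ω (k : Fin n) => X k ω) ⁻¹' Cᶜ := by
    rw [Set.preimage_compl]
    congr 1
    ext ω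
    refine forall_congr' fun i => ?_
    have : ∑ k ∈ Finset.range (κ i), (if h : k < n then X k ω else 0) =
        ∑ k ∈ Finset.range (κ i), X k ω := by
      refine Finset.sum_congr rfl fun k hk => ?_
      have h1 := Finset.le_sup (f := κ) (Finset.mem_univ i)
      have h2 := Finset.mem_range.1 hk
      rw [dif_pos (by omega)]
    rw [← this]
  rw [e]
  exact (hXN n (by omega)).measure_inter_preimage_eq_mul _ _ hCm.compl hKm

theorem measure_ruin_finset_le [IsProbabilityMeasure P] {ι : Type*} [Fintype ι]
    {N : ℝ≥0 → Ω → ℕ} {X X' : ℕ → Ω → ℝ}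
    (hN : ∀ t, Measurable (N t))
    (hX : ∀ k, AEMeasurable (X k) P) (hX' : ∀ k, AEMeasurable (X' k) P)
    (hX0 : ∀ᵐ ω ∂P, ∀ k, 0 ≤ X k ω) (hX'0 : ∀ᵐ ω ∂P, ∀ k, 0 ≤ X' k ω)
    (hXN : ∀ n : ℕ, 1 ≤ n →
      IndepFun (fun ω (k : Fin n) => X k ω) (fun ω (t : ℝ≥0) => N t ω) P)
    (hX'N : ∀ n : ℕ, 1 ≤ n →
      IndepFun (fun ω (k : Fin n) => X' k ω) (fun ω (t : ℝ≥0) => N t ω) P)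
    (h : ∀ (n : ℕ) (ρ : ℕ → ℝ≥0), Monotone ρ →
      P {ω | ∀ m < n, ∑ k ∈ Finset.range (m + 1), X' k ω ≤ ρ m} ≤
        P {ω | ∀ m < n, ∑ k ∈ Finset.range (m + 1), X k ω ≤ ρ m})
    (q : ι → ℝ≥0) (b : ι → ℝ≥0) :
    P {ω | ∃ i, (b i : ℝ) < ∑ k ∈ Finset.range (N (q i) ω), X k ω} ≤
      P {ω | ∃ i, (b i : ℝ) < ∑ k ∈ Finset.range (N (q i) ω), X' k ω} := by
  set NF : Ω → ι → ℕ := fun ω i => N (q i) ω with hNF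
  have hNFm : Measurable NF := measurable_pi_lambda _ fun i => hN (q i)
  have key : ∀ {Z : ℕ → Ω → ℝ}, (∀ n : ℕ, 1 ≤ n →
      IndepFun (fun ω (k : Fin n) => Z k ω) (fun ω (t : ℝ≥0) => N t ω) P) →
      P {ω | ∃ i, (b i : ℝ) < ∑ k ∈ Finset.range (N (q i) ω), Z k ω} =
        ∑' κ : (Set.univ : Set (ι → ℕ)),
          P {ω | ∀ i, ∑ k ∈ Finset.range (κ.1 i), Z k ω ≤ b i}ᶜ *
            P {ω | ∀ i, N (q i) ω = κ.1 i} := by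
    intro Z hZ
    set S := {ω | ∃ i, (b i : ℝ) < ∑ k ∈ Finset.range (N (q i) ω), Z k ω} with hS
    -- Decomposition over the countably many values of the counts. Restricting `P` to `S` requires
    -- no measurability of `S`.
    have h1 := tsum_measure_preimage_singleton (μ := P.restrict S) (s := (Set.univ : Set (ι → ℕ)))
      (Set.to_countable _) (f := NF) fun κ _ => hNFm (measurableSet_singleton κ)
    rw [Set.preimage_univ, Measure.restrict_apply MeasurableSet.univ, Set.univ_inter] at h1
    rw [← h1]
    refine tsum_congr fun κ => ?_
    rw [Measure.restrict_apply (hNFm (measurableSet_singleton _)), ← measure_inter_counts_eq hZ]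
    congr 1
    ext ω
    have hiff : ω ∈ NF ⁻¹' {κ.1} ↔ ∀ i, N (q i) ω = κ.1 i := funext_iff
    constructor
    · rintro ⟨h2, i, hi⟩
      have h3 := hiff.1 h2
      rw [h3 i] at hi
      exact ⟨fun h' => not_lt.2 (h' i) hi, h3⟩
    · rintro ⟨h2, h3⟩
      refine ⟨hiff.2 h3, ?_⟩
      by_contra hcon
      refine h2 fun i => ?_
      rw [← h3 i]
      exact not_lt.1 fun h' => hcon ⟨i, h'⟩
  rw [key hXN, key hX'N]
  exact ENNReal.tsum_le_tsum fun κ =>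
    mul_le_mul_left (measure_exists_lt_sum_le hX hX' hX0 hX'0 h b κ.1) _

theorem measure_ultimateRuin_le [IsProbabilityMeasure P] {u c : ℝ} (hu : 0 ≤ u) (hc : 0 < c)
    {N : ℝ≥0 → Ω → ℕ}
    {X X' : ℕ → Ω → ℝ} (hN : ∀ t, Measurable (N t))
    (hNrc : ∀ᵐ ω ∂P, ∀ t : ℝ≥0, ∀ᶠ s in 𝓝[≥] t, N s ω = N t ω)
    (hX : ∀ k, AEMeasurable (X k) P) (hX' : ∀ k, AEMeasurable (X' k) P)
    (hX0 : ∀ᵐ ω ∂P, ∀ k, 0 ≤ X k ω) (hX'0 : ∀ᵐ ω ∂P, ∀ k, 0 ≤ X' k ω)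
    (hXN : ∀ n : ℕ, 1 ≤ n →
      IndepFun (fun ω (k : Fin n) => X k ω) (fun ω (t : ℝ≥0) => N t ω) P)
    (hX'N : ∀ n : ℕ, 1 ≤ n →
      IndepFun (fun ω (k : Fin n) => X' k ω) (fun ω (t : ℝ≥0) => N t ω) P)
    (h : ∀ (n : ℕ) (ρ : ℕ → ℝ≥0), Monotone ρ →
      P {ω | ∀ m < n, ∑ k ∈ Finset.range (m + 1), X' k ω ≤ ρ m} ≤
        P {ω | ∀ m < n, ∑ k ∈ Finset.range (m + 1), X k ω ≤ ρ m}) :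
    P (ultimateRuin (reserve u c N X)) ≤ P (ultimateRuin (reserve u c N X')) := by
  obtain ⟨D, hDc, hD⟩ := TopologicalSpace.exists_countable_dense ℝ≥0
  have : Countable D := hDc
  set b : ℝ≥0 → ℝ≥0 := fun t => ⟨u + c * t, by positivity⟩ with hb
  set S : (ℕ → Ω → ℝ) → Finset D → Set Ω := fun Z F =>
    {ω | ∃ i : F, (b i.1 : ℝ) < ∑ k ∈ Finset.range (N i.1 ω), Z k ω} with hS
  have hdir : ∀ Z, Directed (· ⊆ ·) (S Z) := fun Z => Monotone.directed_le fun F G hFG ω => by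
    rintro ⟨i, hi⟩
    exact ⟨⟨i.1, hFG i.2⟩, hi⟩
  -- Ruin for `X` must be caught on the dense set, up to a null set; for `X'` the trivial inclusion
  -- `hsub` suffices.
  have hae : (ultimateRuin (reserve u c N X) : Set Ω) ≤ᵐ[P] (⋃ F, S X F : Set Ω) := by
    filter_upwards [hNrc] with ω hω hr
    obtain ⟨t, ht⟩ := mem_ultimateRuin_iff.1 hr
    have hcont : Tendsto (fun s : ℝ≥0 => u + c * (s : ℝ)) (𝓝[>] t) (𝓝 (u + c * t)) := by
      have : Continuous fun s : ℝ≥0 => u + c * (s : ℝ) := by fun_prop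
      exact this.continuousAt.tendsto.mono_left nhdsWithin_le_nhds
    have hev : ∀ᶠ s : ℝ≥0 in 𝓝[>] t, u + c * s < ∑ k ∈ Finset.range (N s ω), X k ω := by
      filter_upwards [hcont.eventually_lt_const ht,
        (hω t).filter_mono (nhdsWithin_mono _ Set.Ioi_subset_Ici_self)] with s h1 h2
      rwa [h2]
    obtain ⟨s, hsD, hs⟩ := exists_mem_dense_of_eventually_nhdsGT hD hev
    exact Set.mem_iUnion.2 ⟨{⟨s, hsD⟩}, ⟨⟨⟨s, hsD⟩, Finset.mem_singleton_self _⟩, hs⟩⟩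
  have hsub : (⋃ F, S X' F) ⊆ ultimateRuin (reserve u c N X') := by
    refine Set.iUnion_subset fun F => ?_
    rintro ω ⟨i, hi⟩
    exact mem_ultimateRuin_iff.2 ⟨i.1, hi⟩
  refine (measure_mono_ae hae).trans (le_trans ?_ (measure_mono hsub))
  rw [(hdir X).measure_iUnion, (hdir X').measure_iUnion]
  exact iSup_mono fun F => measure_ruin_finset_le hN hX hX' hX0 hX'0 hXN hX'N h
    (fun i : F => (i.1 : ℝ≥0)) (fun i : F => b i.1)

end Ruin

/-! ### Laws of the partial sums of the claims -/

section Claims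

variable {Ω : Type*} [MeasurableSpace Ω] {P : Measure Ω}

theorem IsMultivariatePhaseType.exists_measure_eq [IsProbabilityMeasure P] {M : PhaseTypeRep}
    {n : ℕ} {Y : ℕ → Ω → ℝ}
    (hY : IsMultivariatePhaseType M n (fun ω k => Y k ω) P)
    {μ : Measure ℝ} [NullSingletonClass μ] [IsProbabilityMeasure μ] (hn : 0 < n)
    (hμ : μ (Set.Iio 0) = 0) (htail : ∀ k a, 0 ≤ a → ∀ i,
      (NormedSpace.exp (a • M.A k) *ᵥ 1) i ≤ 1 - μ.real (Set.Iic a))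
    {H : ℕ → Ω → ℝ} (hlaw : ∀ k, HasLaw (H k) μ P) (hH : iIndepFun H P) :
    ∃ (Ω' : Type) (_ : MeasurableSpace Ω') (P' : Measure Ω') (_ : IsProbabilityMeasure P')
      (φ : ℝ≥0 → Ω' → M.State n),
      IsMarkovJumpProcess (M.generator n) (M.initial n) φ P' ∧ ∀ ρ : ℕ → ℝ≥0,
        P {ω | ∀ m < n, ∑ k ∈ Finset.range (m + 1), Y k ω ≤ ρ m} =
          P' {ω | ∀ m < n, m + 1 ≤ M.level (φ (ρ m) ω)} := by
  obtain ⟨Ω', _, P', _, φ, hφ, hid⟩ := hY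
  refine ⟨Ω', _, P', ‹_›, φ, hφ, fun ρ => ?_⟩
  -- The blocks are all left eventually by comparison with the walk: its `n` partial sums are below
  -- a common level `N` with probability tending to `1`.
  have hT : Tendsto (fun N : ℕ => P'.real {ω | ∀ m < n, m + 1 ≤ M.level (φ (N : ℝ≥0) ω)}) atTop
      (𝓝 1) := by
    set S : ℕ → Set Ω := fun N =>
      {ω | ∀ j < n, 0 + ∑ i ∈ Finset.range (j + 1), H (0 + i) ω ≤ ((N : ℝ≥0) : ℝ)} with hS
    have hmono : Monotone S := fun N N' hNN ω hω j hj =>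
      (hω j hj).trans (by exact_mod_cast hNN)
    have hun : ⋃ N, S N = Set.univ := by
      refine Set.eq_univ_of_forall fun ω => ?_
      obtain ⟨N, hN⟩ := exists_nat_ge
        (∑ j ∈ Finset.range n, |0 + ∑ i ∈ Finset.range (j + 1), H (0 + i) ω|)
      refine Set.mem_iUnion.2 ⟨N, fun j hj => ?_⟩
      refine (le_abs_self _).trans (le_trans ?_ hN)
      exact Finset.single_le_sum
        (f := fun j => |0 + ∑ i ∈ Finset.range (j + 1), H (0 + i) ω|)
        (fun j _ => abs_nonneg _) (Finset.mem_range.2 hj)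
    have h1 : Tendsto (fun N => P.real (S N)) atTop (𝓝 1) := by
      have := tendsto_measure_iUnion_atTop (μ := P) hmono
      rw [hun, measure_univ] at this
      exact (ENNReal.tendsto_toReal ENNReal.one_ne_top).comp this
    refine tendsto_of_tendsto_of_tendsto_of_le_of_le h1 tendsto_const_nhds (fun N => ?_)
      fun N => measureReal_le_one
    have h2 := PhaseTypeRep.walkSurvival_le_measureReal_level hn hφ
      (ρ := fun _ => (N : ℝ≥0)) monotone_const hμ htail
    refine le_trans ?_ h2
    rw [measureReal_def, hS, measure_partialSum_le_eq_walkSurvival hlaw hH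
      (fun _ => ((N : ℝ≥0) : ℝ)) n 0 0, ENNReal.toReal_ofReal (walkSurvival_nonneg _ _ _ _)]
  rw [← PhaseTypeRep.measure_sum_timeIn_eq hφ hT]
  set C : Set (Fin n → ℝ) := {y | ∀ m < n,
    ∑ k ∈ Finset.univ.filter (fun k : Fin n => (k : ℕ) ≤ m), y k ≤ ρ m} with hC
  have hCm : MeasurableSet C := by
    have : C = ⋂ m, ⋂ (_ : m < n), {y : Fin n → ℝ |
        ∑ k ∈ Finset.univ.filter (fun k : Fin n => (k : ℕ) ≤ m), y k ≤ ρ m} := by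
      ext; simp [hC]
    rw [this]
    exact MeasurableSet.iInter fun m => MeasurableSet.iInter fun _ =>
      measurableSet_le (by fun_prop) measurable_const
  have e : {ω | ∀ m < n, ∑ k ∈ Finset.range (m + 1), Y k ω ≤ ρ m} =
      (fun ω (k : Fin n) => Y k ω) ⁻¹' C := by
    ext ω
    exact forall₂_congr fun m hm => by rw [← sum_filter_fin_le_eq_sum_range hm]
  rw [e, hid.measure_mem_eq hCm]
  rfl

theorem IsMultivariatePhaseType.ae_nonneg {M : PhaseTypeRep} {n : ℕ} {Y : Ω → Fin n → ℝ}
    (hY : IsMultivariatePhaseType M n Y P) (k : Fin n) : ∀ᵐ ω ∂P, 0 ≤ Y ω k := by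
  obtain ⟨Ω', _, P', _, φ, hφ, hid⟩ := hY
  have h := hid.measure_mem_eq (s := {y | y k < 0})
    (measurableSet_lt (measurable_pi_apply k) measurable_const)
  rw [ae_iff]
  simp only [not_le]
  refine Eq.trans h ?_
  have : (fun ω' k => (M.timeIn (fun s => φ s ω') k).toReal) ⁻¹' {y : Fin n → ℝ | y k < 0} = ∅ := by
    ext ω; simp
  rw [this, measure_empty]

theorem IsMultivariatePhaseType.aemeasurable {M : PhaseTypeRep} {n : ℕ} {Y : Ω → Fin n → ℝ}
    (hY : IsMultivariatePhaseType M n Y P) (k : Fin n) : AEMeasurable (fun ω => Y ω k) P := by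
  obtain ⟨Ω', _, P', _, φ, hφ, hid⟩ := hY
  exact (measurable_pi_apply k).comp_aemeasurable hid.aemeasurable_fst

theorem ae_nonneg_of_hasLaw {μ : Measure ℝ} (hμ : μ (Set.Iio 0) = 0) {X : ℕ → Ω → ℝ}
    (hX : ∀ k, HasLaw (X k) μ P) : ∀ᵐ ω ∂P, ∀ k, 0 ≤ X k ω := by
  rw [ae_all_iff]
  intro k
  rw [ae_iff]
  simp only [not_le]
  rw [(hX k).measure_eq (p := fun x => x < 0) measurableSet_Iio]
  exact hμ

theorem measure_partialSum_eq_walkSurvival_zero [IsProbabilityMeasure P] {μ : Measure ℝ}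
    [IsProbabilityMeasure μ] {X : ℕ → Ω → ℝ} (hlaw : ∀ k, HasLaw (X k) μ P)
    (hX : iIndepFun X P) (n : ℕ) (ρ : ℕ → ℝ≥0) :
    P {ω | ∀ m < n, ∑ k ∈ Finset.range (m + 1), X k ω ≤ ρ m} =
      ENNReal.ofReal (walkSurvival μ (fun m => ρ m) 0 n 0) := by
  have := measure_partialSum_le_eq_walkSurvival hlaw hX (fun m => (ρ m : ℝ)) n 0 0
  simpa using this

theorem indepFun_fin_of_indepFun {N : ℝ≥0 → Ω → ℕ} {X : ℕ → Ω → ℝ}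
    (h : IndepFun (fun ω k => X k ω) (fun ω (t : ℝ≥0) => N t ω) P) (n : ℕ) :
    IndepFun (fun ω (k : Fin n) => X k ω) (fun ω (t : ℝ≥0) => N t ω) P :=
  h.comp (φ := fun (x : ℕ → ℝ) (k : Fin n) => x k) (ψ := id)
    (measurable_pi_lambda _ fun _ => measurable_pi_apply _) measurable_id

end Claims

/-! ### Positivity of the parameters, and the main theorem -/

namespace PhaseTypeRep

theorem dim_zero_pos (M : PhaseTypeRep) : 0 < M.dim 0 := by
  by_contra! h
  have h0 : M.dim 0 = 0 := by omega
  have : IsEmpty (Fin (M.dim 0)) := by rw [h0]; infer_instance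
  have := M.α_sum
  simp at this

/-- If `ν ≤ 0`, the lower bound `exp (-ν t)` on the tail would be at least `1`, against transience.
-/
theorem exit_bound_pos (M : PhaseTypeRep) {ν : ℝ} (hν : ∀ k i, -(∑ j, M.A k i j) ≤ ν) : 0 < ν := by
  by_contra! hcon
  set i : Fin (M.dim 0) := ⟨0, M.dim_zero_pos⟩
  have ht : Tendsto (fun t : ℝ => (NormedSpace.exp (t • M.A 0) *ᵥ 1) i) atTop (𝓝 0) := by
    have := tendsto_finsetSum Finset.univ fun j _ => M.transient 0 i j
    simpa [Matrix.mulVec, dotProduct] using this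
  have h1 : (1 : ℝ) ≤ 0 := by
    refine ge_of_tendsto ht ?_
    filter_upwards [eventually_ge_atTop (0 : ℝ)] with t ht
    refine le_trans ?_ (exp_neg_mul_le_exp_smul_mulVec_one (M.A_nonneg 0) (hν 0) ht i)
    exact Real.one_le_exp (by nlinarith)
  linarith

end PhaseTypeRep

theorem mainTheorem8 {Ω : Type*} [MeasurableSpace Ω] (P : Measure Ω) [IsProbabilityMeasure P]
    -- the reserve with dependent phase-type claims
    (u c : ℝ) (hu : 0 ≤ u) (hc : 0 < c)
    (lam : ℝ≥0) (hlam : 0 < lam) (N : ℝ≥0 → Ω → ℕ) (hN : IsPoissonProcess lam N P)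
    (M : PhaseTypeRep) (Y : ℕ → Ω → ℝ)
    (hY : ∀ n : ℕ, 1 ≤ n → IsMultivariatePhaseType M n (fun ω k => Y k ω) P)
    (hYN : ∀ n : ℕ, 1 ≤ n →
      IndepFun (fun ω (k : Fin n) => Y k ω) (fun ω (t : ℝ≥0) => N t ω) P)
    -- bounded dimensions, exit rates and dominant eigenvalues
    (p : ℕ) (hp : ∀ k, M.dim k ≤ p)
    (ν : ℝ) (hν : ∀ k i, -(∑ j, M.A k i j) ≤ ν)
    (σ : ℝ) (hσ : 0 < σ) (hA : ∀ k z, IsDominantEigenvalue (M.A k) z → z.re ≤ -σ)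
    -- i.i.d. exponential claims of rate `ν`, independent of the arrivals
    (L : ℕ → Ω → ℝ) (hLlaw : ∀ k, HasLaw (L k) (expMeasure ν) P) (hL : iIndepFun L P)
    (hLN : IndepFun (fun ω k => L k ω) (fun ω (t : ℝ≥0) => N t ω) P)
    -- i.i.d. Erlang claims with `p` stages of rate `σ`, independent of the arrivals
    (H : ℕ → Ω → ℝ) (hHlaw : ∀ k, HasLaw (H k) (gammaMeasure p σ) P) (hH : iIndepFun H P)
    (hHN : IndepFun (fun ω k => H k ω) (fun ω (t : ℝ≥0) => N t ω) P) :
    P (ultimateRuin (reserve u c N L)) ≤ P (ultimateRuin (reserve u c N Y)) ∧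
      P (ultimateRuin (reserve u c N Y)) ≤ P (ultimateRuin (reserve u c N H)) := by
  have hν0 := M.exit_bound_pos hν
  have hp0 : 0 < p := M.dim_zero_pos.trans_le (hp 0)
  -- The exponential law is an Erlang law with one stage, so both bounds use the same distribution
  -- function.
  have hL1 : expMeasure ν = gammaMeasure ((1 : ℕ) : ℝ) ν := by rw [expMeasure, Nat.cast_one]
  rw [hL1] at hLlaw
  have : IsProbabilityMeasure (gammaMeasure ((1 : ℕ) : ℝ) ν) :=
    isProbabilityMeasure_gammaMeasure (by norm_num) hν0
  have : IsProbabilityMeasure (gammaMeasure p σ) :=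
    isProbabilityMeasure_gammaMeasure (by exact_mod_cast hp0) hσ
  have htailH : ∀ k a, 0 ≤ a → ∀ i, (NormedSpace.exp (a • M.A k) *ᵥ 1) i ≤
      1 - (gammaMeasure p σ).real (Set.Iic a) := by
    intro k a ha i
    rw [gammaMeasure_real_Iic hp0 hσ ha, sub_sub_cancel]
    refine exp_smul_mulVec_one_le_erlang (hp k) (M.A_nonneg k) (fun i => ?_) hσ (hA k) ha i
    have h1 := M.row_sum k i
    have h2 := M.exitRate_nonneg k i
    rw [PhaseTypeRep.exitRate] at h2
    linarith
  have htailL : ∀ k a, 0 ≤ a → ∀ i, 1 - (gammaMeasure ((1 : ℕ) : ℝ) ν).real (Set.Iic a) ≤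
      (NormedSpace.exp (a • M.A k) *ᵥ 1) i := by
    intro k a ha i
    rw [gammaMeasure_real_Iic one_pos hν0 ha, sub_sub_cancel]
    simpa [expPartialSum] using
      exp_neg_mul_le_exp_smul_mulVec_one (M.A_nonneg k) (hν k) ha i
  have hYm : ∀ k, AEMeasurable (Y k) P := fun k =>
    (hY (k + 1) (Nat.le_add_left 1 k)).aemeasurable (Fin.last k)
  have hY0 : ∀ᵐ ω ∂P, ∀ k, 0 ≤ Y k ω := ae_all_iff.2 fun k =>
    (hY (k + 1) (Nat.le_add_left 1 k)).ae_nonneg (Fin.last k)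
  refine ⟨?_, ?_⟩
  · refine measure_ultimateRuin_le hu hc hN.measurable hN.right_continuous
      (fun k => (hLlaw k).aemeasurable) hYm (ae_nonneg_of_hasLaw (gammaMeasure_Iio_zero _ _) hLlaw)
      hY0 (fun n _ => indepFun_fin_of_indepFun hLN n) hYN fun n ρ hρ => ?_
    rcases Nat.eq_zero_or_pos n with rfl | hn
    · simp
    -- The claims `H` enter the lower bound too, only to show that the process leaves all its
    -- blocks.
    obtain ⟨Ω', _, P', _, φ, hφ, heq⟩ := (hY n hn).exists_measure_eq hn
      (gammaMeasure_Iio_zero _ _) htailH hHlaw hH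
    rw [heq, measure_partialSum_eq_walkSurvival_zero hLlaw hL, ← ofReal_measureReal]
    exact ENNReal.ofReal_le_ofReal (PhaseTypeRep.measureReal_level_le_walkSurvival hn hφ hρ
      (gammaMeasure_Iio_zero _ _) htailL)
  · refine measure_ultimateRuin_le hu hc hN.measurable hN.right_continuous hYm
      (fun k => (hHlaw k).aemeasurable) hY0 (ae_nonneg_of_hasLaw (gammaMeasure_Iio_zero _ _) hHlaw)
      hYN (fun n _ => indepFun_fin_of_indepFun hHN n) fun n ρ hρ => ?_
    rcases Nat.eq_zero_or_pos n with rfl | hn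
    · simp
    obtain ⟨Ω', _, P', _, φ, hφ, heq⟩ := (hY n hn).exists_measure_eq hn
      (gammaMeasure_Iio_zero _ _) htailH hHlaw hH
    rw [heq, measure_partialSum_eq_walkSurvival_zero hHlaw hH, ← ofReal_measureReal]
    exact ENNReal.ofReal_le_ofReal (PhaseTypeRep.walkSurvival_le_measureReal_level hn hφ hρ
      (gammaMeasure_Iio_zero _ _) htailH)
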